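/- **Conventions.** Categories are locally small; "small" means indexed by a small category. A *cylinder* $r\colon D\rightsquigarrow E$ between small diagrams $D\colon\mathcal I\to\mathcal C$ and $E\colon\mathcal J\to\mathcal C$ is a family of maps $r_{ij}\colon Di\to Ej$ natural in $i$ and $j$; a cocone $p\colon D\to\Delta V$ and a cone $q\colon\Delta V\to E$ give the cylinder $q\cdot p=(q_j p_i)_{i,j}$. A cocone $p\colon D\to\Delta V$ is *orthogonal* to a cone $q\colon\Delta W\to E$ if for every cocone $h\colon D\to\Delta W$ and cone $k\colon\Delta V\to E$ with $q\cdot h=k\cdot p$ there is a unique $j\colon V\to W$ with $j\cdot p=h$ and $q\cdot j=k$. A *cylinder factorisation system* on $\mathcal C$ consists of a class $\mathcal E$ of small cocones, closed under postcomposition with isomorphisms, and a class $\mathcal M$ of small cones, closed under precomposition with isomorphisms, such that every $p\in\mathcal E$ is orthogonal to every $q\in\mathcal M$ and every small cylinder $r$ factors as $r=q\cdot p$ with $p\in\mathcal E$, $q\in\mathcal M$. Let $\mathbf{CFS}$ be the 2-category of locally small categories with a cylinder factorisation system, functors $F$ with $F(\mathcal E)\subset\mathcal E$ and $F(\mathcal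 M)\subset\mathcal M$, and all natural transformations, and let $U\colon\mathbf{CFS}\to\mathbf{CAT}$ be the forgetful 2-functor to the 2-category of locally small categories. Let $\mathcal P\mathcal C\subset[\mathcal C^{\mathrm{op}},\mathbf{Set}]$ be the full subcategory of small colimits of representables and $\mathcal P^\dagger\mathcal C=\mathcal P(\mathcal C^{\mathrm{op}})^{\mathrm{op}}\subset[\mathcal C,\mathbf{Set}]^{\mathrm{op}}$. The *Isbell envelope* $\mathcal I(\mathcal C)$ has as objects the triples $X=(X^+,X^-,\xi^X)$ with $X^+\in\mathcal P\mathcal C$, $X^-\in\mathcal P^\dagger\mathcal C$ and functions $\xi^X_{ab}\colon X^-(b)\times X^+(a)\to\mathcal C(a,b)$ natural in $a,b$; a morphism $X\to Y$ is a pair $f^+\colon X^+\to Y^+$ in $\mathcal P\mathcal C$, $f^-\colon X^-\to Y^-$ in $\mathcal P^\dagger\mathcal C$ with $\xi^Y_{ab}(y,f^+x)=\xi^X_{ab}(f^-y,x)$ for all $y\in Y^-(b)$, $x\in X^+(a)$. Write $\pi_1,\pi_2$ for the projections to $\mathcal P\mathcal C$ and $\mathcal P^\dagger\mathcal C$, and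 $Y\colon\mathcal C\to\mathcal I(\mathcal C)$ for the Yoneda embedding $c\mapsto(\mathcal C(-,c),\mathcal C(c,-),\circ)$. **Theorem.** (1) For every locally small category $\mathcal C$, the small cocones $p$ in $\mathcal I(\mathcal C)$ with $\pi_1(p)$ colimiting in $\mathcal P\mathcal C$ and the small cones $q$ in $\mathcal I(\mathcal C)$ with $\pi_2(q)$ limiting in $\mathcal P^\dagger\mathcal C$ form a cylinder factorisation system on $\mathcal I(\mathcal C)$; and, for this structure and every locally small category $\mathcal D$ with a cylinder factorisation system, precomposition with $Y$ is an equivalence of categories $$(-)\cdot Y\colon\mathbf{CFS}(\mathcal I(\mathcal C),\mathcal D)\longrightarrow\mathbf{CAT}(\mathcal C,\mathcal D).$$ (2) The 2-functor $U$ has a left biadjoint whose value at every $\mathcal C$ is $\mathcal I(\mathcal C)$, with the cylinder factorisation system of (1), and whose unit at $\mathcal C$ is $Y$: that is, there are a pseudofunctor $L\colon\mathbf{CAT}\to\mathbf{CFS}$ with $L\mathcal C=\mathcal I(\mathcal C)$ and a pseudonatural transformation $\eta\colon 1\to UL$ with $\eta_{\mathcal C}=Y$ such that $g\mapsto Ug\cdot\eta_{\mathcal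 C}$ is an equivalence $\mathbf{CFS}(L\mathcal C,\mathcal D)\simeq\mathbf{CAT}(\mathcal C,U\mathcal D)$ for all $\mathcal C$ and $\mathcal D$. -/

import Mathlib

open CategoryTheory Limits Opposite Bicategory

universe v u w

noncomputable section

namespace IsbellMonad

/-! ### Cylinders and cylinder factorisation systems -/

/-- A cylinder `D ⇝ E`: a family of maps `D i ⟶ E j`, natural in `i` and `j`. -/
abbrev Cylinder {C : Type u} [Category.{v} C] {I J : Type v} [SmallCategory I] [SmallCategory J]
    (D : I ⥤ C) (E : J ⥤ C) : Type v :=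
  CategoryTheory.Prod.fst I J ⋙ D ⟶ CategoryTheory.Prod.snd I J ⋙ E

/-- The cylinder `q · p` obtained from a cocone `p` under `D` and a cone `q` over `E` with the
same vertex. -/
def Cylinder.ofVertex {C : Type u} [Category.{v} C] {I J : Type v} [SmallCategory I]
    [SmallCategory J] {D : I ⥤ C} {E : J ⥤ C} {V : C}
    (p : D ⟶ (Functor.const I).obj V) (q : (Functor.const J).obj V ⟶ E) : Cylinder D E where
  app ij := p.app ij.1 ≫ q.app ij.2
  naturality ij ij' f := by
    have h₁ : D.map f.1 ≫ p.app ij'.1 = p.app ij.1 := by simp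
    have h₂ : q.app ij.2 ≫ E.map f.2 = q.app ij'.2 := by simpa using (q.naturality f.2).symm
    change D.map f.1 ≫ p.app ij'.1 ≫ q.app ij'.2 = (p.app ij.1 ≫ q.app ij.2) ≫ E.map f.2
    rw [← Category.assoc, h₁, Category.assoc, h₂]

/-- Orthogonality of a cocone `p` and a cone `q`: every commuting square of cocones and cones
`q · h = k · p` has a unique diagonal filler. -/
def Orthogonal {C : Type u} [Category.{v} C] {I J : Type v} [SmallCategory I] [SmallCategory J]
    {D : I ⥤ C} {E : J ⥤ C} (p : Cocone D) (q : Cone E) : Prop :=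
  ∀ (h : D ⟶ (Functor.const I).obj q.pt) (k : (Functor.const J).obj p.pt ⟶ E),
    Cylinder.ofVertex h q.π = Cylinder.ofVertex p.ι k →
      ∃! m : p.pt ⟶ q.pt,
        (∀ i : I, p.ι.app i ≫ m = h.app i) ∧ (∀ j : J, m ≫ q.π.app j = k.app j)

/-- A class of small cocones and a class of small cones in a locally small category. -/
structure CylinderClasses (C : Type u) [Category.{v} C] where
  /-- the class of small cocones -/
  E : ∀ ⦃I : Type v⦄ [SmallCategory I] ⦃D : I ⥤ C⦄, Cocone D → Prop
  /-- the class of small cones -/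
  M : ∀ ⦃J : Type v⦄ [SmallCategory J] ⦃D : J ⥤ C⦄, Cone D → Prop

/-- The axioms of a cylinder factorisation system. -/
structure CylinderClasses.IsFactorizationSystem {C : Type u} [Category.{v} C]
    (S : CylinderClasses C) : Prop where
  E_iso : ∀ {I : Type v} [SmallCategory I] {D : I ⥤ C} (p : Cocone D) {W : C} (f : p.pt ≅ W),
    S.E p → S.E (p.extend f.hom)
  M_iso : ∀ {J : Type v} [SmallCategory J] {D : J ⥤ C} (q : Cone D) {V : C} (f : V ≅ q.pt),
    S.M q → S.M (q.extend f.hom)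
  orthogonal : ∀ {I J : Type v} [SmallCategory I] [SmallCategory J] {D : I ⥤ C} {E : J ⥤ C}
    (p : Cocone D) (q : Cone E), S.E p → S.M q → Orthogonal p q
  factorization : ∀ {I J : Type v} [SmallCategory I] [SmallCategory J] {D : I ⥤ C} {E : J ⥤ C}
    (r : Cylinder D E), ∃ (V : C) (p : D ⟶ (Functor.const I).obj V)
      (q : (Functor.const J).obj V ⟶ E),
      S.E (Cocone.mk V p) ∧ S.M (Cone.mk V q) ∧ r = Cylinder.ofVertex p q

/-- The functors that send `E`-cocones to `E`-cocones and `M`-cones to `M`-cones. -/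
def preservesClasses {C : Type u} [Category.{v} C] {D : Type w} [Category.{v} D]
    (S : CylinderClasses C) (T : CylinderClasses D) : ObjectProperty (C ⥤ D) := fun F =>
  (∀ {I : Type v} [SmallCategory I] {A : I ⥤ C} (p : Cocone A), S.E p → T.E (F.mapCocone p)) ∧
  (∀ {J : Type v} [SmallCategory J] {A : J ⥤ C} (q : Cone A), S.M q → T.M (F.mapCone q))

/-! ### The 2-category of cylinder factorisation systems -/

/-- A locally small category equipped with a cylinder factorisation system. -/
structure CFS : Type (max (u + 1) (v + 1)) where
  /-- the underlying category -/
  carrier : Cat.{v, u}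
  /-- the classes of cocones and cones -/
  classes : CylinderClasses.{v, u} carrier
  isFactorizationSystem : classes.IsFactorizationSystem

namespace CFS

/-- Morphisms are the functors preserving both classes. -/
instance categoryStruct : CategoryStruct CFS.{v, u} where
  Hom X Y := (preservesClasses X.classes Y.classes).FullSubcategory
  id X := ⟨𝟭 X.carrier, fun _ h => h, fun _ h => h⟩
  comp F G := ⟨F.obj ⋙ G.obj, fun p h => G.property.1 _ (F.property.1 p h),
    fun q h => G.property.2 _ (F.property.2 q h)⟩

/-- 2-cells are arbitrary natural transformations. -/
instance homCategory (X Y : CFS.{v, u}) : Category (X ⟶ Y) :=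
  inferInstanceAs (Category (preservesClasses X.classes Y.classes).FullSubcategory)

@[ext]
theorem hom₂_ext {X Y : CFS.{v, u}} {F G : X ⟶ Y} {η θ : F ⟶ G}
    (h : ∀ x : X.carrier, η.hom.app x = θ.hom.app x) : η = θ :=
  ObjectProperty.hom_ext _ (NatTrans.ext (funext h))

@[simp]
theorem id_obj (X : CFS.{v, u}) :
    ObjectProperty.FullSubcategory.obj (𝟙 X : X ⟶ X) = 𝟭 X.carrier := rfl

@[simp]
theorem comp_obj {X Y Z : CFS.{v, u}} (F : X ⟶ Y) (G : Y ⟶ Z) :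
    ObjectProperty.FullSubcategory.obj (F ≫ G) = F.obj ⋙ G.obj := rfl

@[simp]
theorem id_hom {X Y : CFS.{v, u}} (F : X ⟶ Y) :
    InducedCategory.Hom.hom (𝟙 F : F ⟶ F) = 𝟙 F.obj := rfl

@[simp]
theorem comp_hom {X Y : CFS.{v, u}} {F G H : X ⟶ Y} (η : F ⟶ G) (θ : G ⟶ H) :
    InducedCategory.Hom.hom (η ≫ θ) = η.hom ≫ θ.hom := rfl

instance bicategory : Bicategory CFS.{v, u} where
  homCategory := homCategory
  whiskerLeft F _ _ η := ObjectProperty.homMk (Functor.whiskerLeft F.obj η.hom)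
  whiskerRight η H := ObjectProperty.homMk (Functor.whiskerRight η.hom H.obj)
  associator F G H := ObjectProperty.isoMk _ (Functor.associator F.obj G.obj H.obj)
  leftUnitor F := ObjectProperty.isoMk _ (Functor.leftUnitor F.obj)
  rightUnitor F := ObjectProperty.isoMk _ (Functor.rightUnitor F.obj)

end CFS

/-- The forgetful 2-functor from categories with a cylinder factorisation system to locally small
categories. -/
def forget : CFS.{v, u} ⥤ᵖ Cat.{v, u} where
  obj X := X.carrier
  map F := Cat.Hom.ofFunctor F.obj
  map₂ η := Cat.Hom₂.ofNatTrans η.hom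
  mapId _ := Iso.refl _
  mapComp _ _ := Iso.refl _

/-! ### Left biadjoints -/

/-- `η : a ⟶ U x` is biuniversal from `a` to `U`: for every `b`, the functor
`B(x, b) ⥤ A(a, U b)`, `g ↦ U g · η`, is an equivalence of categories. -/
def IsBiuniversal {A : Type*} {B : Type*} [Bicategory A] [Bicategory B] (U : B ⥤ᵖ A) {a : A}
    {x : B} (η : a ⟶ U.obj x) : Prop :=
  ∀ b : B, (U.mapFunctor x b ⋙ precomp (U.obj b) η).IsEquivalence

/-- A left biadjoint to `U`, presented by its unit: a pseudofunctor `L` with a pseudonatural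
transformation from the identity to `U L` all of whose components are biuniversal. -/
structure LeftBiadjoint {A : Type*} {B : Type*} [Bicategory A] [Bicategory B]
    (U : B ⥤ᵖ A) where
  /-- the left biadjoint pseudofunctor -/
  L : A ⥤ᵖ B
  /-- the unit -/
  unit : Pseudofunctor.StrongTrans (Pseudofunctor.id A) (L.comp U)
  isBiuniversal : ∀ a : A, IsBiuniversal U (x := L.obj a) (unit.app a)

/-! ### Small presheaves -/

/-- A presheaf is small if it is a small colimit of representables. -/
def isSmallPresheaf (C : Type u) [Category.{v} C] : ObjectProperty (Cᵒᵖ ⥤ Type v) := fun X =>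
  ∃ (J : Type v) (_ : SmallCategory J) (D : J ⥤ C)
    (p : D ⋙ yoneda ⟶ (Functor.const J).obj X), Nonempty (IsColimit (Cocone.mk X p))

/-- A covariant presheaf is small if it is a small colimit of corepresentables. -/
def isSmallCopresheaf (C : Type u) [Category.{v} C] : ObjectProperty (C ⥤ Type v) := fun X =>
  ∃ (J : Type v) (_ : SmallCategory J) (D : J ⥤ Cᵒᵖ)
    (p : D ⋙ coyoneda ⟶ (Functor.const J).obj X), Nonempty (IsColimit (Cocone.mk X p))

/-- The category `𝒫 C` of small presheaves. -/
abbrev SmallPresheaf (C : Type u) [Category.{v} C] := (isSmallPresheaf C).FullSubcategory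

/-- The category `𝒫† C = 𝒫(Cᵒᵖ)ᵒᵖ`. -/
abbrev DualSmallPresheaf (C : Type u) [Category.{v} C] := (isSmallCopresheaf C).FullSubcategoryᵒᵖ

theorem isSmallPresheaf_yoneda {C : Type u} [Category.{v} C] (c : C) :
    isSmallPresheaf C (yoneda.obj c) :=
  ⟨PUnit, inferInstance, (Functor.const _).obj c, { app := fun _ => 𝟙 _ },
    ⟨{ desc := fun s => s.ι.app ⟨⟩
       fac := fun s j => by simp
       uniq := fun s m hm => by simpa using hm ⟨⟩ }⟩⟩

theorem isSmallCopresheaf_coyoneda {C : Type u} [Category.{v} C] (c : C) :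
    isSmallCopresheaf C (coyoneda.obj (op c)) :=
  ⟨PUnit, inferInstance, (Functor.const _).obj (op c), { app := fun _ => 𝟙 _ },
    ⟨{ desc := fun s => s.ι.app ⟨⟩
       fac := fun s j => by simp
       uniq := fun s m hm => by simpa using hm ⟨⟩ }⟩⟩

instance locallySmall_smallPresheaf (C : Type u) [Category.{v} C] :
    LocallySmall.{v} (SmallPresheaf C) where
  hom_small X Y := by
    obtain ⟨J, _, D, p, ⟨hp⟩⟩ := X.property
    refine small_of_injective
      (f := fun (f : X ⟶ Y) (j : J) => f.hom.app (op (D.obj j)) ((p.app j).app _ (𝟙 (D.obj j)))) ?_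
    intro f g h
    refine ObjectProperty.hom_ext _ (hp.hom_ext fun j => yonedaEquiv.injective ?_)
    exact congrFun h j

instance locallySmall_smallCopresheaf (C : Type u) [Category.{v} C] :
    LocallySmall.{v} (isSmallCopresheaf C).FullSubcategory where
  hom_small X Y := by
    obtain ⟨J, _, D, p, ⟨hp⟩⟩ := X.property
    refine small_of_injective
      (f := fun (f : X ⟶ Y) (j : J) =>
        f.hom.app (D.obj j).unop ((p.app j).app _ (𝟙 (D.obj j).unop))) ?_
    intro f g h
    refine ObjectProperty.hom_ext _ (hp.hom_ext fun j => coyonedaEquiv.injective ?_)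
    exact congrFun h j

/-! ### The Isbell envelope -/

/-- An object of the Isbell envelope: `X⁺ ∈ 𝒫 C`, `X⁻ ∈ 𝒫† C` and a family of functions
`ξ : X⁻ b × X⁺ a → C(a, b)`, natural in `a` and `b`. -/
structure Isbell (C : Type u) [Category.{v} C] where
  /-- `X⁺` -/
  pos : SmallPresheaf C
  /-- `X⁻` -/
  neg : DualSmallPresheaf C
  /-- `ξ` -/
  ξ : ∀ a b : C, neg.unop.obj.obj b × pos.obj.obj (op a) → (a ⟶ b)
  naturality : ∀ {a a' b b' : C} (f : a' ⟶ a) (g : b ⟶ b') (y : neg.unop.obj.obj b)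
    (x : pos.obj.obj (op a)),
    ξ a' b' (neg.unop.obj.map g y, pos.obj.map f.op x) = f ≫ ξ a b (y, x) ≫ g

namespace Isbell

/-- A morphism of the Isbell envelope: `f⁺ : X⁺ ⟶ Y⁺` in `𝒫 C` and `f⁻ : X⁻ ⟶ Y⁻` in `𝒫† C`
compatible with the families `ξ`. -/
@[ext]
structure Hom {C : Type u} [Category.{v} C] (X Y : Isbell C) where
  /-- `f⁺` -/
  pos : X.pos ⟶ Y.pos
  /-- `f⁻` -/
  neg : X.neg ⟶ Y.neg
  comm : ∀ (a b : C) (y : Y.neg.unop.obj.obj b) (x : X.pos.obj.obj (op a)),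
    Y.ξ a b (y, pos.hom.app (op a) x) = X.ξ a b (neg.unop.hom.app b y, x)

instance category (C : Type u) [Category.{v} C] : Category (Isbell C) where
  Hom := Hom
  id X := { pos := 𝟙 _, neg := 𝟙 _, comm := fun _ _ _ _ => rfl }
  comp f g :=
    { pos := f.pos ≫ g.pos
      neg := f.neg ≫ g.neg
      comm := fun a b y x =>
        (g.comm a b y (f.pos.hom.app (op a) x)).trans (f.comm a b (g.neg.unop.hom.app b y) x) }

@[ext]
theorem hom_ext {C : Type u} [Category.{v} C] {X Y : Isbell C} {f g : X ⟶ Y}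
    (h₁ : f.pos = g.pos) (h₂ : f.neg = g.neg) : f = g :=
  Hom.ext h₁ h₂

instance locallySmall (C : Type u) [Category.{v} C] : LocallySmall.{v} (Isbell C) where
  hom_small X Y := small_of_injective
    (f := fun f : X ⟶ Y => ((f.pos, f.neg) : (X.pos ⟶ Y.pos) × (X.neg ⟶ Y.neg)))
    fun _ _ h => hom_ext (congrArg Prod.fst h) (congrArg Prod.snd h)

/-- The projection to `𝒫 C`. -/
def posFunctor (C : Type u) [Category.{v} C] : Isbell C ⥤ SmallPresheaf C where
  obj X := X.pos
  map f := f.pos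

/-- The projection to `𝒫† C`. -/
def negFunctor (C : Type u) [Category.{v} C] : Isbell C ⥤ DualSmallPresheaf C where
  obj X := X.neg
  map f := f.neg

/-- The Yoneda embedding `c ↦ (C(-, c), C(c, -), ∘)`. -/
def yonedaEmbedding (C : Type u) [Category.{v} C] : C ⥤ Isbell C where
  obj c :=
    { pos := ⟨yoneda.obj c, isSmallPresheaf_yoneda c⟩
      neg := op ⟨coyoneda.obj (op c), isSmallCopresheaf_coyoneda c⟩
      ξ := fun a b (gf : (c ⟶ b) × (a ⟶ c)) => gf.2 ≫ gf.1
      naturality := fun f g (y : c ⟶ _) (x : _ ⟶ c) => by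
        change (f ≫ x) ≫ y ≫ g = f ≫ (x ≫ y) ≫ g
        simp }
  map {c d} k :=
    { pos := ObjectProperty.homMk (yoneda.map k)
      neg := Quiver.Hom.op (ObjectProperty.homMk (coyoneda.map k.op))
      comm := fun a b (y : d ⟶ b) (x : a ⟶ c) => by
        change (x ≫ k) ≫ y = x ≫ k ≫ y
        simp }
  map_id c := by
    apply hom_ext
    · exact ObjectProperty.hom_ext _ (yoneda.map_id c)
    · exact congrArg Quiver.Hom.op (ObjectProperty.hom_ext _ (coyoneda.map_id (op c)))
  map_comp {c d e} k l := by
    apply hom_ext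
    · exact ObjectProperty.hom_ext _ (yoneda.map_comp k l)
    · exact congrArg Quiver.Hom.op (ObjectProperty.hom_ext _ (coyoneda.map_comp l.op k.op))

end Isbell

/-- The Isbell envelope `ℐ C` as a locally small category: the category `Isbell C`, whose hom-sets
are `v`-small, with each hom-set replaced by a copy in `Type v`. -/
abbrev Envelope (C : Type u) [Category.{v} C] : Type (max u (v + 1)) :=
  ShrinkHoms.{max u (v + 1)} (Isbell C)

namespace Envelope

/-- `π₁ : ℐ C ⥤ 𝒫 C` -/
def π₁ (C : Type u) [Category.{v} C] : Envelope C ⥤ SmallPresheaf C :=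
  ShrinkHoms.inverse (Isbell C) ⋙ Isbell.posFunctor C

/-- `π₂ : ℐ C ⥤ 𝒫† C` -/
def π₂ (C : Type u) [Category.{v} C] : Envelope C ⥤ DualSmallPresheaf C :=
  ShrinkHoms.inverse (Isbell C) ⋙ Isbell.negFunctor C

/-- `Y : C ⥤ ℐ C` -/
def Y (C : Type u) [Category.{v} C] : C ⥤ Envelope C :=
  Isbell.yonedaEmbedding C ⋙ ShrinkHoms.functor (Isbell C)

/-- The cocones `p` with `π₁ p` colimiting in `𝒫 C`, and the cones `q` with `π₂ q` limiting in
`𝒫† C`. -/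
def classes (C : Type u) [Category.{v} C] : CylinderClasses.{v} (Envelope C) where
  E _ _ _ p := Nonempty (IsColimit ((π₁ C).mapCocone p))
  M _ _ _ q := Nonempty (IsLimit ((π₂ C).mapCone q))

/-- The Isbell envelope with its classes of cocones and cones, as an object of the 2-category of
cylinder factorisation systems (given that the classes satisfy the axioms). -/
def toCFS (C : Type u) [Category.{v} C] (h : (classes C).IsFactorizationSystem) :
    CFS.{v, max u (v + 1)} where
  carrier := Cat.of (Envelope C)
  classes := classes C
  isFactorizationSystem := h

/-- Precomposition with `Y`, from functors `ℐ C ⥤ D` preserving the two classes to functors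
`C ⥤ D`. -/
def restrict (C : Type u) [Category.{v} C] {D : Type w} [Category.{v} D]
    (T : CylinderClasses D) : (preservesClasses (classes C) T).FullSubcategory ⥤ (C ⥤ D) :=
  (preservesClasses (classes C) T).ι ⋙ (Functor.whiskeringLeft C (Envelope C) D).obj (Y C)

end Envelope

end IsbellMonad

end

/-! By the Yoneda lemma, maps `Y c ⟶ X` are the elements of `X⁺(c)`, maps `X ⟶ Y c` are the elements
of `X⁻(c)`, and the composite of `x` and `y` is `Y` applied to `ξ(y, x)`. Thus an object of the
envelope is a formal vertex, known only through the maps into it and out of it and their composites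
in `C`.

This gives the factorisation system. A filler `m` of a square from `p ∈ E` to `q ∈ M` has `m⁺`
forced by the colimit `p⁺` and `m⁻` forced by the colimit `q⁻`; commutativity of the square is
exactly the compatibility of `m⁺` and `m⁻`, tested on representatives (`orthogonal_classes`). A
cylinder from `D` to `E` factors through the object `V` with `V⁺` the colimit of the `D i⁺`, `V⁻`
the colimit of the `E j⁻`, and `ξ` read off from the cylinder (`exists_factorization`). That `V`
lies in the envelope needs small presheaves to be closed under small colimits: all representables
involved lie in one small full subcategory, and a functor determined by its restriction there is
small.

For the universal property, each `X` is the vertex of an `E`-cocone under, and an `M`-cone over,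
small diagrams of representables, so `X` factorises a cylinder of maps of `C`. A functor preserving
both classes must send `X` to a factorisation of the image cylinder, and orthogonality makes fillers
between such factorisations unique. Existence and uniqueness of fillers yield fullness and
faithfulness (`existsUnique_extend_app`). Conversely, given `G`, choosing a factorisation for every
`X` defines an extension (`exists_extension_obj`, `existsUnique_map`); it preserves the classes
because any cocone orthogonal to all of `M` lies in `E`, and dually.

The biadjoint is then formal: 2-cells out of `ℐ A` are determined by their components at
representables, so every coherence law is checked there. -/

noncomputable section

namespace IsbellMonad

/-! ### Small presheaves are closed under small colimits -/

/-- `X` is the left Kan extension of its restriction along `ι`. -/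
def IsDeterminedOn {C : Type u} [Category.{v} C] {K : Type v} [SmallCategory K] (ι : K ⥤ C) :
    ObjectProperty (C ⥤ Type v) := fun X =>
  ∀ Y : C ⥤ Type v, Function.Bijective
    (fun f : X ⟶ Y => (Functor.whiskerLeft ι f : ι ⋙ X ⟶ ι ⋙ Y))

namespace IsDeterminedOn

variable {C : Type u} [Category.{v} C] {K : Type v} [SmallCategory K] {ι : K ⥤ C}

/-- The Yoneda argument survives restriction: by fullness every element of the restricted functor is
a translate of the identity by a map of `K`. Faithfulness plays no role. -/
theorem coyoneda_obj [ι.Full] (k : K) : IsDeterminedOn ι (coyoneda.obj (op (ι.obj k))) := by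
  intro Y
  constructor
  · intro f g h
    apply coyonedaEquiv.injective
    exact ConcreteCategory.congr_hom (NatTrans.congr_app h k) (𝟙 (ι.obj k))
  · intro g
    refine ⟨coyonedaEquiv.symm (g.app k (𝟙 (ι.obj k))), ?_⟩
    ext k' (u : ι.obj k ⟶ ι.obj k')
    obtain ⟨t, rfl⟩ := ι.map_surjective u
    have := NatTrans.naturality_apply g t (𝟙 (ι.obj k))
    have h2 : (ι ⋙ coyoneda.obj (op (ι.obj k))).map t (𝟙 (ι.obj k)) = ι.map t :=
      Category.id_comp _
    rw [h2] at this
    exact this.symm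

/-- Restriction along `ι` preserves colimits, so maps out of `c.pt` and out of its restriction are
both compatible families indexed by `I`, matched termwise. -/
theorem of_isColimit {I : Type v} [SmallCategory I] {D : I ⥤ C ⥤ Type v} {c : Cocone D}
    (hc : IsColimit c) (h : ∀ i, IsDeterminedOn ι (D.obj i)) : IsDeterminedOn ι c.pt := by
  intro Y
  have hc' := isColimitOfPreserves ((Functor.whiskeringLeft _ _ (Type v)).obj ι) hc
  constructor
  · intro f g hfg
    refine hc.hom_ext fun i => (h i Y).1 ?_
    have : Functor.whiskerLeft ι f = Functor.whiskerLeft ι g := hfg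
    simp only [Functor.whiskerLeft_comp, this]
  · intro g
    choose s hs using fun i => (h i Y).2 (Functor.whiskerLeft ι (c.ι.app i) ≫ g)
    have nat : ∀ {i i' : I} (f : i ⟶ i'), D.map f ≫ s i' = s i := by
      intro i i' f
      refine (h i Y).1 ?_
      have h1 := hs i
      have h2 := hs i'
      dsimp only at h1 h2 ⊢
      rw [Functor.whiskerLeft_comp, h1, h2, ← Category.assoc, ← Functor.whiskerLeft_comp, c.w]
    refine ⟨hc.desc ⟨Y, { app := s, naturality := fun i i' f => by simp [nat] }⟩, ?_⟩
    refine hc'.hom_ext fun i => ?_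
    have h1 := hs i
    dsimp only at h1 ⊢
    change Functor.whiskerLeft ι (c.ι.app i) ≫ _ = Functor.whiskerLeft ι (c.ι.app i) ≫ g
    rw [← h1, ← Functor.whiskerLeft_comp, hc.fac]

/-- Density: `X` is the colimit of corepresentables over the elements of its restriction to `K`, and
these form a small category because `K` is small. -/
theorem isSmallCopresheaf {X : C ⥤ Type v} (h : IsDeterminedOn ι X) : isSmallCopresheaf C X := by
  let D : (ι ⋙ X).Elementsᵒᵖ ⥤ Cᵒᵖ := (CategoryOfElements.π (ι ⋙ X) ⋙ ι).op
  let p : D ⋙ coyoneda ⟶ (Functor.const _).obj X :=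
    { app := fun x => coyonedaEquiv.symm (show X.obj (ι.obj x.unop.1) from x.unop.2)
      naturality := fun x y f => by
        have hf : X.map (ι.map f.unop.1) y.unop.2 = x.unop.2 := f.unop.2
        ext b (t : ι.obj x.unop.1 ⟶ b)
        change X.map (ι.map f.unop.1 ≫ t) y.unop.2 = X.map t x.unop.2
        refine Eq.trans ?_ (congrArg (X.map t) hf)
        exact Functor.map_comp_apply X (ι.map f.unop.1) t y.unop.2 }
  have hp : ∀ (x : (ι ⋙ X).Elementsᵒᵖ) {Z : C ⥤ Type v} (f : X ⟶ Z),
      (p.app x ≫ f).app _ (𝟙 (ι.obj x.unop.1)) = f.app (ι.obj x.unop.1) x.unop.2 := by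
    intro x Z f
    change f.app (ι.obj x.unop.1) (X.map (𝟙 _) x.unop.2) = _
    simp
  refine ⟨_, inferInstance, D, p, ⟨?_⟩⟩
  have key : ∀ s : Cocone (D ⋙ coyoneda), ∃ f : X ⟶ s.pt, ∀ x, p.app x ≫ f = s.ι.app x := by
    intro s
    -- A cocone only prescribes values at objects coming from `K`; determinacy extends them to all
    -- of `X`.
    let g : ι ⋙ X ⟶ ι ⋙ s.pt :=
      { app := fun k => ↾fun x => (s.ι.app (op ⟨k, x⟩)).app _ (𝟙 (ι.obj k))
        naturality := fun k k' t => by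
          ext x
          have := s.w (Quiver.Hom.op (CategoryOfElements.homMk ((ι ⋙ X).elementsMk k x)
            ((ι ⋙ X).elementsMk k' ((ι ⋙ X).map t x)) t rfl))
          have h1 := ConcreteCategory.congr_hom (NatTrans.congr_app this (ι.obj k')) (𝟙 (ι.obj k'))
          have h2 := NatTrans.naturality_apply (s.ι.app (op ⟨k, x⟩)) (ι.map t) (𝟙 (ι.obj k))
          refine h1.symm.trans (Eq.trans ?_ h2)
          change (s.ι.app (op ⟨k, x⟩)).app _ (ι.map t ≫ 𝟙 _) =
            (s.ι.app (op ⟨k, x⟩)).app _ (𝟙 _ ≫ ι.map t)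
          simp }
    obtain ⟨f, hf⟩ := (h s.pt).2 g
    refine ⟨f, fun x => coyonedaEquiv.injective ?_⟩
    refine (hp x f).trans ?_
    exact ConcreteCategory.congr_hom (NatTrans.congr_app hf x.unop.1) x.unop.2
  exact
    { desc := fun s => (key s).choose
      fac := fun s => (key s).choose_spec
      uniq := fun s m hm => by
        refine (h s.pt).1 ?_
        ext k x
        have h1 := hp (op ⟨k, x⟩) m
        have h2 := hp (op ⟨k, x⟩) (key s).choose
        have h3 := (key s).choose_spec (op ⟨k, x⟩)
        have h4 := hm (op ⟨k, x⟩)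
        dsimp only at h4
        rw [h4] at h1
        rw [h3] at h2
        exact h1.symm.trans h2 }

end IsDeterminedOn

theorem isSmallCopresheaf_of_isColimit {C : Type u} [Category.{v} C] {I : Type v} [SmallCategory I]
    {D : I ⥤ C ⥤ Type v} {c : Cocone D} (hc : IsColimit c)
    (h : ∀ i, isSmallCopresheaf C (D.obj i)) : isSmallCopresheaf C c.pt := by
  choose J hJ E p hp using h
  -- All corepresenting objects of all `D i` at once. Their full subcategory is small since `C` is
  -- locally small, which avoids amalgamating the diagrams `E i`.
  let o : (Σ i, J i) → C := fun x => ((E x.1).obj x.2).unop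
  refine IsDeterminedOn.isSmallCopresheaf (ι := inducedFunctor o)
    (IsDeterminedOn.of_isColimit hc fun i => ?_)
  exact IsDeterminedOn.of_isColimit (hp i).some fun j =>
    IsDeterminedOn.coyoneda_obj (ι := inducedFunctor o) (⟨i, j⟩ : Σ i, J i)

/-- Representable presheaves on `C` are corepresentable functors on `Cᵒᵖ`. -/
def yonedaIsoCoyonedaOp (C : Type u) [Category.{v} C] :
    CategoryTheory.yoneda ≅ opOp C ⋙ (coyoneda : Cᵒᵖᵒᵖ ⥤ Cᵒᵖ ⥤ Type v) :=
  NatIso.ofComponents (fun c => NatIso.ofComponents (fun a => ((opEquiv (op c) a).toIso).symm))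

theorem isSmallPresheaf_iff {C : Type u} [Category.{v} C] (X : Cᵒᵖ ⥤ Type v) :
    isSmallPresheaf C X ↔ isSmallCopresheaf Cᵒᵖ X := by
  constructor
  · rintro ⟨J, _, D, p, ⟨hp⟩⟩
    let e : D ⋙ CategoryTheory.yoneda ≅ (D ⋙ opOp C) ⋙ coyoneda :=
      Functor.isoWhiskerLeft D (yonedaIsoCoyonedaOp C)
    exact ⟨J, _, D ⋙ opOp C, e.inv ≫ p, ⟨(IsColimit.precomposeInvEquiv e _).symm hp⟩⟩
  · rintro ⟨J, _, D, p, ⟨hp⟩⟩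
    let e : (D ⋙ unopUnop C) ⋙ CategoryTheory.yoneda ≅ D ⋙ coyoneda :=
      Functor.isoWhiskerLeft (D ⋙ unopUnop C) (yonedaIsoCoyonedaOp C)
    exact ⟨J, _, D ⋙ unopUnop C, e.hom ≫ p, ⟨(IsColimit.precomposeHomEquiv e _).symm hp⟩⟩

theorem isSmallPresheaf_of_isColimit {C : Type u} [Category.{v} C] {I : Type v} [SmallCategory I]
    {D : I ⥤ Cᵒᵖ ⥤ Type v} {c : Cocone D} (hc : IsColimit c)
    (h : ∀ i, isSmallPresheaf C (D.obj i)) : isSmallPresheaf C c.pt :=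
  (isSmallPresheaf_iff _).2
    (isSmallCopresheaf_of_isColimit hc fun i => (isSmallPresheaf_iff _).1 (h i))

namespace Envelope

/-! ### Elements of objects of the Isbell envelope -/

/-- The underlying presheaf `X ↦ X⁺`. -/
def posFun (C : Type u) [Category.{v} C] : Envelope C ⥤ Cᵒᵖ ⥤ Type v :=
  π₁ C ⋙ (isSmallPresheaf C).ι

/-- The underlying copresheaf `X ↦ X⁻`. -/
def negFun (C : Type u) [Category.{v} C] : (Envelope C)ᵒᵖ ⥤ C ⥤ Type v :=
  (π₂ C).leftOp ⋙ (isSmallCopresheaf C).ι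

variable {C : Type u} [Category.{v} C]

/-- `X⁺` -/
abbrev pos (X : Envelope C) : Cᵒᵖ ⥤ Type v := (posFun C).obj X

/-- `X⁻` -/
abbrev neg (X : Envelope C) : C ⥤ Type v := (negFun C).obj (op X)

/-- `f⁺` -/
abbrev mapPos {X X' : Envelope C} (f : X ⟶ X') : pos X ⟶ pos X' := (posFun C).map f

/-- `f⁻` -/
abbrev mapNeg {X X' : Envelope C} (f : X ⟶ X') : neg X' ⟶ neg X := (negFun C).map f.op

theorem isSmallPresheaf_pos (X : Envelope C) : isSmallPresheaf C (pos X) :=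
  ((π₁ C).obj X).property

theorem isSmallCopresheaf_neg (X : Envelope C) : isSmallCopresheaf C (neg X) :=
  ((π₂ C).obj X).unop.property

/-- The pairing `ξ`. -/
def pair (X : Envelope C) {a b : C} (y : (neg X).obj b) (x : (pos X).obj (op a)) : a ⟶ b :=
  (ShrinkHoms.fromShrinkHoms X).ξ a b (y, x)

theorem pair_map (X : Envelope C) {a a' b b' : C} (f : a' ⟶ a) (g : b ⟶ b')
    (y : (neg X).obj b) (x : (pos X).obj (op a)) :
    pair X ((neg X).map g y) ((pos X).map f.op x) = f ≫ pair X y x ≫ g :=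
  (ShrinkHoms.fromShrinkHoms X).naturality f g y x

theorem pair_map_pos (X : Envelope C) {a a' b : C} (f : a' ⟶ a)
    (y : (neg X).obj b) (x : (pos X).obj (op a)) :
    pair X y ((pos X).map f.op x) = f ≫ pair X y x := by
  have := pair_map X f (𝟙 b) y x
  simpa using this

theorem pair_map_neg (X : Envelope C) {a b b' : C} (g : b ⟶ b')
    (y : (neg X).obj b) (x : (pos X).obj (op a)) :
    pair X ((neg X).map g y) x = pair X y x ≫ g := by
  have := pair_map X (𝟙 a) g y x
  simpa using this

theorem pair_mapPos {X X' : Envelope C} (f : X ⟶ X') {a b : C} (y : (neg X').obj b)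
    (x : (pos X).obj (op a)) :
    pair X' y ((mapPos f).app _ x) = pair X ((mapNeg f).app _ y) x :=
  ((ShrinkHoms.inverse (Isbell C)).map f).comm a b y x

theorem hom_ext {X X' : Envelope C} {f g : X ⟶ X'} (h₁ : mapPos f = mapPos g)
    (h₂ : mapNeg f = mapNeg g) : f = g :=
  (ShrinkHoms.inverse (Isbell C)).map_injective
    (Isbell.hom_ext (ObjectProperty.hom_ext _ h₁)
      (Quiver.Hom.unop_inj (ObjectProperty.hom_ext _ h₂)))

/-- The hom-sets of the envelope are shrunk copies, so morphisms are built through this lemma and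
compared through `hom_ext`. -/
theorem exists_hom {X X' : Envelope C} (s : pos X ⟶ pos X') (t : neg X' ⟶ neg X)
    (h : ∀ {a b : C} (y : (neg X').obj b) (x : (pos X).obj (op a)),
      pair X' y (s.app _ x) = pair X (t.app _ y) x) :
    ∃ f : X ⟶ X', mapPos f = s ∧ mapNeg f = t := by
  let k : Isbell.Hom (ShrinkHoms.fromShrinkHoms X) (ShrinkHoms.fromShrinkHoms X') :=
    { pos := ObjectProperty.homMk s
      neg := Quiver.Hom.op (ObjectProperty.homMk t)
      comm := fun a b y x => h y x }
  obtain ⟨f, hf⟩ := (ShrinkHoms.inverse (Isbell C)).map_surjective (X := X) (Y := X') k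
  refine ⟨f, ?_, ?_⟩
  · exact congrArg (fun l : Isbell.Hom _ _ => l.pos.hom) hf
  · exact congrArg (fun l : Isbell.Hom _ _ => l.neg.unop.hom) hf

/-- The object with given components. -/
def mk (P : Cᵒᵖ ⥤ Type v) (hP : isSmallPresheaf C P) (Q : C ⥤ Type v)
    (hQ : isSmallCopresheaf C Q) (ξ : ∀ {a b : C}, Q.obj b → P.obj (op a) → (a ⟶ b))
    (hξ : ∀ {a a' b b' : C} (f : a' ⟶ a) (g : b ⟶ b') (y : Q.obj b) (x : P.obj (op a)),
      ξ (Q.map g y) (P.map f.op x) = f ≫ ξ y x ≫ g) : Envelope C :=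
  ShrinkHoms.toShrinkHoms
    { pos := ⟨P, hP⟩
      neg := op ⟨Q, hQ⟩
      ξ := fun _ _ yx => ξ yx.1 yx.2
      naturality := fun f g y x => hξ f g y x }

/-! ### Morphisms out of and into representables -/

/-- A morphism as an element of `(Y c)⁺`. -/
def toPos {a c : C} (u : a ⟶ c) : (pos ((Y C).obj c)).obj (op a) := u

/-- A morphism as an element of `(Y c)⁻`. -/
def toNeg {c b : C} (u : c ⟶ b) : (neg ((Y C).obj c)).obj b := u

theorem pos_map_toPos {c a a' : C} (u : a' ⟶ a) (t : a ⟶ c) :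
    (pos ((Y C).obj c)).map u.op (toPos t) = toPos (u ≫ t) := rfl

theorem neg_map_toNeg {c b b' : C} (u : b ⟶ b') (t : c ⟶ b) :
    (neg ((Y C).obj c)).map u (toNeg t) = toNeg (t ≫ u) := rfl

theorem pair_toNeg_toPos {a c b : C} (t : c ⟶ b) (u : a ⟶ c) :
    pair ((Y C).obj c) (toNeg t) (toPos u) = u ≫ t := rfl

/-- The Yoneda lemma for `(Y c)⁺`. -/
def posDesc {Z : Cᵒᵖ ⥤ Type v} {c : C} (z : Z.obj (op c)) : pos ((Y C).obj c) ⟶ Z :=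
  (yonedaEquiv.symm z : CategoryTheory.yoneda.obj c ⟶ Z)

/-- The Yoneda lemma for `(Y c)⁻`. -/
def negDesc {Z : C ⥤ Type v} {c : C} (z : Z.obj c) : neg ((Y C).obj c) ⟶ Z :=
  (coyonedaEquiv.symm z : coyoneda.obj (op c) ⟶ Z)

theorem app_toPos {Z : Cᵒᵖ ⥤ Type v} {a c : C} (s : pos ((Y C).obj c) ⟶ Z) (u : a ⟶ c) :
    s.app (op a) (toPos u) = Z.map u.op (s.app (op c) (toPos (𝟙 c))) := by
  rw [← NatTrans.naturality_apply, pos_map_toPos, Category.comp_id]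

theorem app_toNeg {Z : C ⥤ Type v} {b c : C} (s : neg ((Y C).obj c) ⟶ Z) (u : c ⟶ b) :
    s.app b (toNeg u) = Z.map u (s.app c (toNeg (𝟙 c))) := by
  rw [← NatTrans.naturality_apply, neg_map_toNeg, Category.id_comp]

theorem pos_hom_ext {Z : Cᵒᵖ ⥤ Type v} {c : C} {s t : pos ((Y C).obj c) ⟶ Z}
    (h : s.app (op c) (toPos (𝟙 c)) = t.app (op c) (toPos (𝟙 c))) : s = t := by
  ext a u
  exact (app_toPos s (show a.unop ⟶ c from u)).trans (Eq.trans (by rw [h]) (app_toPos t _).symm)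

theorem neg_hom_ext {Z : C ⥤ Type v} {c : C} {s t : neg ((Y C).obj c) ⟶ Z}
    (h : s.app c (toNeg (𝟙 c)) = t.app c (toNeg (𝟙 c))) : s = t := by
  ext b u
  exact (app_toNeg s (show c ⟶ b from u)).trans (Eq.trans (by rw [h]) (app_toNeg t _).symm)

/-- The negative component is forced to be `y ↦ ξ(y, x)`; compatibility is naturality of `ξ` in its
contravariant variable. -/
theorem exists_ofPos {X : Envelope C} {c : C} (x : (pos X).obj (op c)) :
    ∃ f : (Y C).obj c ⟶ X,
      ∀ {a : C} (u : a ⟶ c), (mapPos f).app (op a) (toPos u) = (pos X).map u.op x := by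
  let s : CategoryTheory.yoneda.obj c ⟶ pos X := yonedaEquiv.symm x
  let t : neg X ⟶ coyoneda.obj (op c) :=
    { app := fun b => ↾fun y => pair X y x
      naturality := fun b b' g => by
        ext y
        exact pair_map_neg X g y x }
  obtain ⟨f, hs, -⟩ := exists_hom (X := (Y C).obj c) (X' := X) s t
    (fun y u => pair_map_pos X u y x)
  exact ⟨f, fun u => ConcreteCategory.congr_hom (NatTrans.congr_app hs _) _⟩

theorem exists_ofNeg {X : Envelope C} {c : C} (y : (neg X).obj c) :
    ∃ f : X ⟶ (Y C).obj c,
      (∀ {a : C} (x : (pos X).obj (op a)), (mapPos f).app (op a) x = toPos (pair X y x)) ∧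
      ∀ {b : C} (u : c ⟶ b), (mapNeg f).app b (toNeg u) = (neg X).map u y := by
  let s : pos X ⟶ CategoryTheory.yoneda.obj c :=
    { app := fun a => ↾fun x => pair X y (show (pos X).obj (op a.unop) from x)
      naturality := fun a a' g => by
        ext x
        exact pair_map_pos X g.unop y x }
  let t : coyoneda.obj (op c) ⟶ neg X := coyonedaEquiv.symm y
  obtain ⟨f, hs, ht⟩ := exists_hom (X := X) (X' := (Y C).obj c) s t
    (fun u x => (pair_map_neg X u y x).symm)
  exact ⟨f, fun x => ConcreteCategory.congr_hom (NatTrans.congr_app hs _) x,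
    fun u => ConcreteCategory.congr_hom (NatTrans.congr_app ht _) _⟩

/-- The morphism `Y c ⟶ X` corresponding to an element of `X⁺`. -/
def ofPos {X : Envelope C} {c : C} (x : (pos X).obj (op c)) : (Y C).obj c ⟶ X :=
  (exists_ofPos x).choose

/-- The morphism `X ⟶ Y c` corresponding to an element of `X⁻`. -/
def ofNeg {X : Envelope C} {c : C} (y : (neg X).obj c) : X ⟶ (Y C).obj c :=
  (exists_ofNeg y).choose

theorem mapPos_ofPos {X : Envelope C} {c a : C} (x : (pos X).obj (op c)) (u : a ⟶ c) :
    (mapPos (ofPos x)).app (op a) (toPos u) = (pos X).map u.op x :=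
  (exists_ofPos x).choose_spec u

theorem mapPos_ofNeg {X : Envelope C} {c a : C} (y : (neg X).obj c) (x : (pos X).obj (op a)) :
    (mapPos (ofNeg y)).app (op a) x = toPos (pair X y x) :=
  (exists_ofNeg y).choose_spec.1 x

theorem mapNeg_ofNeg {X : Envelope C} {c b : C} (y : (neg X).obj c) (u : c ⟶ b) :
    (mapNeg (ofNeg y)).app b (toNeg u) = (neg X).map u y :=
  (exists_ofNeg y).choose_spec.2 u

theorem mapPos_comp {X X' X'' : Envelope C} (f : X ⟶ X') (g : X' ⟶ X'') :
    mapPos (f ≫ g) = mapPos f ≫ mapPos g :=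
  (posFun C).map_comp f g

theorem mapNeg_comp {X X' X'' : Envelope C} (f : X ⟶ X') (g : X' ⟶ X'') :
    mapNeg (f ≫ g) = mapNeg g ≫ mapNeg f :=
  (negFun C).map_comp g.op f.op

theorem mapPos_comp_apply {X X' X'' : Envelope C} (f : X ⟶ X') (g : X' ⟶ X'') {a : Cᵒᵖ}
    (x : (pos X).obj a) :
    (mapPos (f ≫ g)).app a x = (mapPos g).app a ((mapPos f).app a x) :=
  ConcreteCategory.congr_hom (NatTrans.congr_app ((posFun C).map_comp f g) a) x

theorem mapNeg_comp_apply {X X' X'' : Envelope C} (f : X ⟶ X') (g : X' ⟶ X'') {b : C}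
    (y : (neg X'').obj b) :
    (mapNeg (f ≫ g)).app b y = (mapNeg f).app b ((mapNeg g).app b y) :=
  ConcreteCategory.congr_hom (NatTrans.congr_app ((negFun C).map_comp g.op f.op) b) y

theorem mapPos_id_apply {X : Envelope C} {a : Cᵒᵖ} (x : (pos X).obj a) :
    (mapPos (𝟙 X)).app a x = x :=
  ConcreteCategory.congr_hom (NatTrans.congr_app ((posFun C).map_id X) a) x

theorem mapNeg_id_apply {X : Envelope C} {b : C} (y : (neg X).obj b) :
    (mapNeg (𝟙 X)).app b y = y :=
  ConcreteCategory.congr_hom (NatTrans.congr_app ((negFun C).map_id (op X)) b) y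

theorem inverse_map_Y_map {c c' : C} (u : c ⟶ c') :
    (ShrinkHoms.inverse (Isbell C)).map ((Y C).map u) = (Isbell.yonedaEmbedding C).map u :=
  (equivShrink _).symm_apply_apply _

theorem mapPos_Y_map {a c c' : C} (u : c ⟶ c') (t : a ⟶ c) :
    (mapPos ((Y C).map u)).app (op a) (toPos t) = toPos (t ≫ u) :=
  ConcreteCategory.congr_hom (NatTrans.congr_app
    (congrArg (fun l : Isbell.Hom _ _ => l.pos.hom) (inverse_map_Y_map u)) (op a)) _

theorem mapNeg_Y_map {b c c' : C} (u : c ⟶ c') (t : c' ⟶ b) :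
    (mapNeg ((Y C).map u)).app b (toNeg t) = toNeg (u ≫ t) :=
  ConcreteCategory.congr_hom (NatTrans.congr_app
    (congrArg (fun l : Isbell.Hom _ _ => l.neg.unop.hom) (inverse_map_Y_map u)) b) _

/-- Morphisms out of `Y c` agree if they agree on the generic element. -/
theorem hom_ext_toPos {X : Envelope C} {c : C} {f g : (Y C).obj c ⟶ X}
    (h : (mapPos f).app _ (toPos (𝟙 c)) = (mapPos g).app _ (toPos (𝟙 c))) : f = g := by
  refine hom_ext (pos_hom_ext h) ?_
  · ext b y
    -- Pairing with the identity recovers an element of `(Y c)⁻`, so compatibility determines `f⁻`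
    -- from `f⁺`.
    have hf := pair_mapPos f y (toPos (𝟙 c))
    have hg := pair_mapPos g y (toPos (𝟙 c))
    rw [h, hg] at hf
    exact (Category.id_comp _).symm.trans (hf.symm.trans (Category.id_comp _))

/-- Morphisms into `Y c` agree if they agree on the generic element. -/
theorem hom_ext_toNeg {X : Envelope C} {c : C} {f g : X ⟶ (Y C).obj c}
    (h : (mapNeg f).app _ (toNeg (𝟙 c)) = (mapNeg g).app _ (toNeg (𝟙 c))) : f = g := by
  refine hom_ext ?_ (neg_hom_ext h)
  · ext a x
    have hf := pair_mapPos f (toNeg (𝟙 c)) (show (pos X).obj (op a.unop) from x)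
    have hg := pair_mapPos g (toNeg (𝟙 c)) (show (pos X).obj (op a.unop) from x)
    rw [h, ← hg] at hf
    exact (Category.comp_id _).symm.trans (hf.trans (Category.comp_id _))

theorem ofPos_comp {X X' : Envelope C} {c : C} (x : (pos X).obj (op c)) (f : X ⟶ X') :
    ofPos x ≫ f = ofPos ((mapPos f).app _ x) := by
  apply hom_ext_toPos
  rw [mapPos_comp_apply, mapPos_ofPos, mapPos_ofPos, NatTrans.naturality_apply]

theorem comp_ofNeg {X X' : Envelope C} {c : C} (y : (neg X').obj c) (f : X ⟶ X') :
    f ≫ ofNeg y = ofNeg ((mapNeg f).app _ y) := by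
  apply hom_ext_toNeg
  rw [mapNeg_comp_apply, mapNeg_ofNeg, mapNeg_ofNeg, NatTrans.naturality_apply]

theorem map_comp_ofPos {X : Envelope C} {c c' : C} (u : c' ⟶ c) (x : (pos X).obj (op c)) :
    (Y C).map u ≫ ofPos x = ofPos ((pos X).map u.op x) := by
  apply hom_ext_toPos
  rw [mapPos_comp_apply, mapPos_Y_map, mapPos_ofPos, mapPos_ofPos]
  simp

theorem ofNeg_comp_map {X : Envelope C} {c c' : C} (u : c ⟶ c') (y : (neg X).obj c) :
    ofNeg y ≫ (Y C).map u = ofNeg ((neg X).map u y) := by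
  apply hom_ext_toNeg
  rw [mapNeg_comp_apply, mapNeg_Y_map, mapNeg_ofNeg, mapNeg_ofNeg]
  simp

/-- Here `ξ` acquires its meaning as composition through `X`. -/
theorem ofPos_comp_ofNeg {X : Envelope C} {c c' : C} (x : (pos X).obj (op c))
    (y : (neg X).obj c') : ofPos x ≫ ofNeg y = (Y C).map (pair X y x) := by
  apply hom_ext_toPos
  rw [mapPos_comp_apply, mapPos_Y_map, mapPos_ofPos, mapPos_ofNeg, pair_map_pos]

theorem ofPos_toPos {c c' : C} (u : c ⟶ c') : ofPos (toPos u) = (Y C).map u := by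
  apply hom_ext_toPos
  rw [mapPos_ofPos, mapPos_Y_map, pos_map_toPos]

theorem ofNeg_toNeg {c c' : C} (u : c ⟶ c') : ofNeg (toNeg u) = (Y C).map u := by
  apply hom_ext_toNeg
  rw [mapNeg_ofNeg, mapNeg_Y_map, neg_map_toNeg]

theorem eq_ofPos {X : Envelope C} {c : C} (f : (Y C).obj c ⟶ X) :
    f = ofPos ((mapPos f).app _ (toPos (𝟙 c))) := by
  rw [← ofPos_comp, ofPos_toPos, CategoryTheory.Functor.map_id, Category.id_comp]

theorem eq_ofNeg {X : Envelope C} {c : C} (f : X ⟶ (Y C).obj c) :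
    f = ofNeg ((mapNeg f).app _ (toNeg (𝟙 c))) := by
  rw [← comp_ofNeg, ofNeg_toNeg, CategoryTheory.Functor.map_id, Category.comp_id]

end Envelope

/-- Closure makes the inclusion into all presheaves preserve and reflect small colimits, so the
classes of the envelope can be tested pointwise on sets. -/
instance isClosedUnderColimitsOfShape_isSmallPresheaf (C : Type u) [Category.{v} C] (I : Type v)
    [SmallCategory I] : (isSmallPresheaf C).IsClosedUnderColimitsOfShape I where
  colimitsOfShape_le := by
    rintro X ⟨h⟩
    exact isSmallPresheaf_of_isColimit h.isColimit h.prop_diag_obj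

instance isClosedUnderColimitsOfShape_isSmallCopresheaf (C : Type u) [Category.{v} C] (I : Type v)
    [SmallCategory I] : (isSmallCopresheaf C).IsClosedUnderColimitsOfShape I where
  colimitsOfShape_le := by
    rintro X ⟨h⟩
    exact isSmallCopresheaf_of_isColimit h.isColimit h.prop_diag_obj

theorem Cylinder.ofVertex_eq_iff {C : Type u} [Category.{v} C] {I J : Type v} [SmallCategory I]
    [SmallCategory J] {D : I ⥤ C} {E : J ⥤ C} {V W : C}
    {p : D ⟶ (Functor.const I).obj V} {q : (Functor.const J).obj V ⟶ E}
    {h : D ⟶ (Functor.const I).obj W} {k : (Functor.const J).obj W ⟶ E} :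
    ofVertex p q = ofVertex h k ↔
      ∀ i j, (p.app i : D.obj i ⟶ V) ≫ (q.app j : V ⟶ E.obj j) =
        (h.app i : D.obj i ⟶ W) ≫ (k.app j : W ⟶ E.obj j) :=
  ⟨fun H i j => NatTrans.congr_app H (i, j), fun H => NatTrans.ext (funext fun ij => H ij.1 ij.2)⟩

namespace Envelope

variable {C : Type u} [Category.{v} C]

/-! ### The two classes in terms of elements -/

theorem classes_E_iff {I : Type v} [SmallCategory I] {D : I ⥤ Envelope C} {p : Cocone D} :
    (classes C).E p ↔ Nonempty (IsColimit ((posFun C).mapCocone p)) :=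
  ⟨fun ⟨h⟩ => ⟨isColimitOfPreserves (isSmallPresheaf C).ι h⟩,
    fun ⟨h⟩ => ⟨isColimitOfReflects (isSmallPresheaf C).ι h⟩⟩

/-- A limit in `𝒫† C` is a colimit of small copresheaves, so both classes become colimit conditions.
-/
theorem classes_M_iff {J : Type v} [SmallCategory J] {D : J ⥤ Envelope C} {q : Cone D} :
    (classes C).M q ↔ Nonempty (IsColimit ((negFun C).mapCocone q.op)) :=
  ⟨fun ⟨h⟩ => ⟨isColimitOfPreserves (isSmallCopresheaf C).ι (isColimitCoconeLeftOpOfCone _ h)⟩,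
    fun ⟨h⟩ => ⟨isLimitOfCoconeLeftOpOfCone _
      (isColimitOfReflects (isSmallCopresheaf C).ι h)⟩⟩

section

variable {I : Type v} [SmallCategory I] {D : I ⥤ Envelope C} {p : Cocone D}

theorem exists_rep_pos (hp : (classes C).E p) {a : C} (x : (pos p.pt).obj (op a)) :
    ∃ (i : I) (x' : (pos (D.obj i)).obj (op a)), (mapPos (p.ι.app i)).app _ x' = x :=
  Types.jointly_surjective _
    (isColimitOfPreserves ((evaluation _ _).obj (op a)) (classes_E_iff.1 hp).some) x

theorem exists_desc_pos (hp : (classes C).E p) {Z : Cᵒᵖ ⥤ Type v}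
    (t : ∀ i, pos (D.obj i) ⟶ Z)
    (ht : ∀ {i i' : I} (f : i ⟶ i'), mapPos (D.map f) ≫ t i' = t i) :
    ∃ s : pos p.pt ⟶ Z, ∀ i, mapPos (p.ι.app i) ≫ s = t i :=
  ⟨(classes_E_iff.1 hp).some.desc
      ⟨Z, { app := t, naturality := fun _ _ f => (ht f).trans (Category.comp_id _).symm }⟩,
    fun i => (classes_E_iff.1 hp).some.fac _ i⟩

theorem hom_ext_pos (hp : (classes C).E p) {Z : Cᵒᵖ ⥤ Type v} {s t : pos p.pt ⟶ Z}
    (h : ∀ i, mapPos (p.ι.app i) ≫ s = mapPos (p.ι.app i) ≫ t) : s = t :=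
  (classes_E_iff.1 hp).some.hom_ext h

variable {q : Cone D}

theorem exists_rep_neg (hq : (classes C).M q) {b : C} (y : (neg q.pt).obj b) :
    ∃ (j : I) (y' : (neg (D.obj j)).obj b), (mapNeg (q.π.app j)).app _ y' = y := by
  obtain ⟨j, y', h⟩ := Types.jointly_surjective _
    (isColimitOfPreserves ((evaluation _ _).obj b) (classes_M_iff.1 hq).some) y
  exact ⟨j.unop, y', h⟩

theorem exists_desc_neg (hq : (classes C).M q) {Z : C ⥤ Type v}
    (t : ∀ i, neg (D.obj i) ⟶ Z)
    (ht : ∀ {i i' : I} (f : i ⟶ i'), mapNeg (D.map f) ≫ t i = t i') :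
    ∃ s : neg q.pt ⟶ Z, ∀ i, mapNeg (q.π.app i) ≫ s = t i :=
  ⟨(classes_M_iff.1 hq).some.desc
      ⟨Z, { app := fun i => t i.unop,
            naturality := fun _ _ f => (ht f.unop).trans (Category.comp_id _).symm }⟩,
    fun i => (classes_M_iff.1 hq).some.fac _ (op i)⟩

theorem hom_ext_neg (hq : (classes C).M q) {Z : C ⥤ Type v} {s t : neg q.pt ⟶ Z}
    (h : ∀ i, mapNeg (q.π.app i) ≫ s = mapNeg (q.π.app i) ≫ t) : s = t :=
  (classes_M_iff.1 hq).some.hom_ext fun i => h i.unop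

end

/-! ### The cylinder factorisation system on the Isbell envelope -/

/-- The square provides `m⁺` through `h` and `m⁻` through `k`. Identities not immediate from these
definitions are tested against the jointly epimorphic legs `p⁺` and `q⁻`. -/
theorem orthogonal_classes {I J : Type v} [SmallCategory I] [SmallCategory J]
    {D : I ⥤ Envelope C} {E : J ⥤ Envelope C} (p : Cocone D) (q : Cone E)
    (hp : (classes C).E p) (hq : (classes C).M q) : Orthogonal p q := by
  intro h k H
  rw [Cylinder.ofVertex_eq_iff] at H
  obtain ⟨s, hs⟩ := exists_desc_pos hp (fun i => mapPos (h.app i : D.obj i ⟶ q.pt))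
    (fun {i i'} f => by
      have e : D.map f ≫ h.app i' = h.app i := by simp
      rw [← Functor.map_comp]
      exact congrArg mapPos e)
  obtain ⟨t, ht⟩ := exists_desc_neg hq (fun j => mapNeg (k.app j : p.pt ⟶ E.obj j))
    (fun {j j'} f => by
      have e : k.app j ≫ E.map f = k.app j' := by simpa using (k.naturality f).symm
      refine ((negFun C).map_comp (E.map f).op (k.app j).op).symm.trans ?_
      exact congrArg mapNeg e)
  have hs' : ∀ i {a : C} (x : (pos (D.obj i)).obj (op a)),
      s.app _ ((mapPos (p.ι.app i)).app _ x) = (mapPos (h.app i : D.obj i ⟶ q.pt)).app _ x :=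
    fun i a x => ConcreteCategory.congr_hom (NatTrans.congr_app (hs i) _) x
  have ht' : ∀ j {b : C} (y : (neg (E.obj j)).obj b),
      t.app _ ((mapNeg (q.π.app j)).app _ y) = (mapNeg (k.app j : p.pt ⟶ E.obj j)).app _ y :=
    fun j b y => ConcreteCategory.congr_hom (NatTrans.congr_app (ht j) _) y
  obtain ⟨m, hm₁, hm₂⟩ := exists_hom (X := p.pt) (X' := q.pt) s t (fun y x => by
    obtain ⟨i, x, rfl⟩ := exists_rep_pos hp x
    obtain ⟨j, y, rfl⟩ := exists_rep_neg hq y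
    -- Both sides become the pairing of `y` with an image of `x` in `E j`, along `q j · h i` and
    -- along `k j · p i`.
    erw [hs', ht', ← pair_mapPos, ← pair_mapPos, ← mapPos_comp_apply, ← mapPos_comp_apply, H])
  refine ⟨m, ⟨fun i => hom_ext ?_ ?_, fun j => hom_ext ?_ ?_⟩, fun m' hm' => hom_ext ?_ ?_⟩
  · rw [mapPos_comp, hm₁]
    exact hs i
  · refine hom_ext_neg hq fun j => ?_
    rw [mapNeg_comp, hm₂, ← Category.assoc, ht j]
    exact (mapNeg_comp _ _).symm.trans ((congrArg mapNeg (H i j)).symm.trans (mapNeg_comp _ _))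
  · refine hom_ext_pos hp fun i => ?_
    rw [mapPos_comp, hm₁, ← Category.assoc, hs i]
    exact (mapPos_comp _ _).symm.trans ((congrArg mapPos (H i j)).trans (mapPos_comp _ _))
  · rw [mapNeg_comp, hm₂]
    exact ht j
  · refine hom_ext_pos hp fun i => ?_
    rw [hm₁, hs, ← hm'.1 i, mapPos_comp]
  · refine hom_ext_neg hq fun j => ?_
    rw [hm₂, ht, ← hm'.2 j, mapNeg_comp]

/-- The cylinder induces `s j : V⁺ ⟶ E j⁺` and `t i : V⁻ ⟶ D i⁻`. The legs of the factorisation are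
the coprojections paired with these maps. -/
theorem exists_factorization {I J : Type v} [SmallCategory I] [SmallCategory J]
    {D : I ⥤ Envelope C} {E : J ⥤ Envelope C} (r : Cylinder D E) :
    ∃ (V : Envelope C) (p : D ⟶ (Functor.const I).obj V) (q : (Functor.const J).obj V ⟶ E),
      (classes C).E (Cocone.mk V p) ∧ (classes C).M (Cone.mk V q) ∧ r = Cylinder.ofVertex p q := by
  have r_left : ∀ {i i' : I} (f : i ⟶ i') (j : J),
      D.map f ≫ (r.app (i', j) : D.obj i' ⟶ E.obj j) = r.app (i, j) := fun {i i'} f j => by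
    have := r.naturality (X := (i, j)) (Y := (i', j)) (f, 𝟙 j)
    simpa using this
  have r_right : ∀ (i : I) {j j' : J} (f : j ⟶ j'),
      (r.app (i, j) : D.obj i ⟶ E.obj j) ≫ E.map f = r.app (i, j') := fun i {j j'} f => by
    have := r.naturality (X := (i, j)) (Y := (i, j')) (𝟙 i, f)
    simpa using this.symm
  let cP := colimit.cocone (D ⋙ posFun C)
  have hP : IsColimit cP := colimit.isColimit _
  let cQ := colimit.cocone (E.op ⋙ negFun C)
  have hQ : IsColimit cQ := colimit.isColimit _
  have hPr : ∀ {a : C} (x : cP.pt.obj (op a)), ∃ (i : I) (x' : (pos (D.obj i)).obj (op a)),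
      (cP.ι.app i).app _ x' = x := fun {a} x =>
    Types.jointly_surjective _ (isColimitOfPreserves ((evaluation _ _).obj (op a)) hP) x
  choose s hs using fun j : J => show ∃ s : cP.pt ⟶ pos (E.obj j),
      ∀ i, cP.ι.app i ≫ s = mapPos (r.app (i, j)) from
    ⟨hP.desc ⟨_, { app := fun i => mapPos (r.app (i, j)),
                   naturality := fun i i' f => by
                    refine Eq.trans ?_ (Category.comp_id _).symm
                    exact (mapPos_comp _ _).symm.trans (congrArg mapPos (r_left f j)) }⟩,
      fun i => hP.fac _ i⟩
  choose t ht using fun i : I => show ∃ t : cQ.pt ⟶ neg (D.obj i),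
      ∀ j, cQ.ι.app (op j) ≫ t = mapNeg (r.app (i, j)) from
    ⟨hQ.desc ⟨_, { app := fun j => mapNeg (r.app (i, j.unop)),
                   naturality := fun j j' f => by
                    refine Eq.trans ?_ (Category.comp_id _).symm
                    exact (mapNeg_comp _ _).symm.trans (congrArg mapNeg (r_right i f.unop)) }⟩,
      fun j => hQ.fac _ (op j)⟩
  have t_nat : ∀ {i i' : I} (f : i ⟶ i'), t i' ≫ mapNeg (D.map f) = t i := fun {i i'} f =>
    hQ.hom_ext fun j => by
      obtain ⟨j⟩ := j
      rw [← Category.assoc, ht, ht]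
      exact (mapNeg_comp _ _).symm.trans (congrArg mapNeg (r_left f j))
  have s_nat : ∀ {j j' : J} (f : j ⟶ j'), s j ≫ mapPos (E.map f) = s j' := fun {j j'} f =>
    hP.hom_ext fun i => by
      rw [← Category.assoc, hs, hs]
      exact (mapPos_comp _ _).symm.trans (congrArg mapPos (r_right i f))
  -- For fixed `y`, the pairing on `V⁺` is glued from the pairings of the `D i` with `t i y`; they
  -- agree along `D` by naturality of `t`.
  choose g hg using fun {b : C} (y : cQ.pt.obj b) => show ∃ g : cP.pt ⟶ pos ((Y C).obj b),
      ∀ i, cP.ι.app i ≫ g = mapPos (ofNeg ((t i).app b y)) from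
    ⟨hP.desc ⟨_, { app := fun i => mapPos (ofNeg ((t i).app b y)),
                   naturality := fun i i' f => by
                    refine Eq.trans ?_ (Category.comp_id _).symm
                    refine (mapPos_comp _ _).symm.trans (congrArg mapPos ?_)
                    rw [comp_ofNeg]
                    exact congrArg ofNeg (ConcreteCategory.congr_hom
                      (NatTrans.congr_app (t_nat f) b) y) }⟩,
      fun i => hP.fac _ i⟩
  let ξ : ∀ {a b : C}, cQ.pt.obj b → cP.pt.obj (op a) → (a ⟶ b) :=
    fun {a b} y x => (g y).app (op a) x
  have hξ : ∀ {a b : C} (y : cQ.pt.obj b) (i : I) (x : (pos (D.obj i)).obj (op a)),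
      ξ y ((cP.ι.app i).app _ x) = pair (D.obj i) ((t i).app b y) x := fun {a b} y i x =>
    (ConcreteCategory.congr_hom (NatTrans.congr_app (hg y i) (op a)) x).trans
      (mapPos_ofNeg _ _)
  let V : Envelope C := mk cP.pt
    (isSmallPresheaf_of_isColimit hP fun i => isSmallPresheaf_pos (D.obj i)) cQ.pt
    (isSmallCopresheaf_of_isColimit hQ fun j => isSmallCopresheaf_neg (E.obj j.unop)) ξ
    (fun {a a' b b'} f g y x => by
      obtain ⟨i, x, rfl⟩ := hPr x
      rw [← NatTrans.naturality_apply]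
      erw [hξ, hξ]
      rw [NatTrans.naturality_apply]
      exact pair_map _ _ _ _ _)
  choose p hp₁ hp₂ using fun i => exists_hom (X := D.obj i) (X' := V) (cP.ι.app i) (t i)
    (fun y x => hξ y i x)
  choose q hq₁ hq₂ using fun j => exists_hom (X := V) (X' := E.obj j) (s j) (cQ.ι.app (op j))
    (fun {a b} y x => by
      obtain ⟨i, x, rfl⟩ := hPr x
      refine Eq.trans ?_ (hξ _ i x).symm
      have h₁ := ConcreteCategory.congr_hom (NatTrans.congr_app (hs j i) (op a)) x
      have h₂ := ConcreteCategory.congr_hom (NatTrans.congr_app (ht i j) b) y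
      refine (congrArg (pair _ y) h₁).trans (Eq.trans ?_ (congrArg (pair _ · x) h₂.symm))
      exact pair_mapPos _ _ _)
  refine ⟨V, { app := p, naturality := fun i i' f => ?_ },
    { app := q, naturality := fun j j' f => ?_ }, ?_, ?_, ?_⟩
  · refine Eq.trans (hom_ext ?_ ?_) (Category.comp_id _).symm
    · rw [mapPos_comp, hp₁, hp₁]
      exact cP.w f
    · rw [mapNeg_comp, hp₂, hp₂]
      exact t_nat f
  · refine (Category.id_comp _).trans (hom_ext ?_ ?_)
    · rw [mapPos_comp, hq₁, hq₁]
      exact (s_nat f).symm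
    · rw [mapNeg_comp, hq₂, hq₂]
      exact (cQ.w f.op).symm
  · exact classes_E_iff.2 ⟨hP.ofIsoColimit (Cocone.ext (Iso.refl _) fun i =>
      (Category.comp_id _).trans (hp₁ i).symm)⟩
  · exact classes_M_iff.2 ⟨hQ.ofIsoColimit (Cocone.ext (Iso.refl _) fun j =>
      (Category.comp_id _).trans (hq₂ j.unop).symm)⟩
  · refine NatTrans.ext (funext fun ij => hom_ext ?_ ?_)
    · refine Eq.trans ?_ (mapPos_comp (p ij.1) (q ij.2)).symm
      rw [hp₁, hq₁]
      exact (hs ij.2 ij.1).symm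
    · refine Eq.trans ?_ (mapNeg_comp (p ij.1) (q ij.2)).symm
      rw [hp₂, hq₂]
      exact (ht ij.1 ij.2).symm

theorem isFactorizationSystem_classes (C : Type u) [Category.{v} C] :
    (classes C).IsFactorizationSystem where
  E_iso p _ f hp := ⟨IsColimit.ofIsoColimit hp.some
    (Cocone.ext ((π₁ C).mapIso f) fun i => ((π₁ C).map_comp (p.ι.app i) f.hom).symm)⟩
  M_iso q _ f hq := ⟨IsLimit.ofIsoLimit hq.some
    (Cone.ext ((π₂ C).mapIso f.symm) fun i =>
      (congrArg (π₂ C).map (f.inv_hom_id_assoc (q.π.app i))).symm.trans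
        ((π₂ C).map_comp f.inv (f.hom ≫ q.π.app i)))⟩
  orthogonal := orthogonal_classes
  factorization := exists_factorization

end Envelope

/-! ### Each class of a cylinder factorisation system determines the other -/

/-- The retract argument: factor `p`, viewed as a cylinder to a one-object diagram, as `q · p'`.
Orthogonality of `p` to `q` makes the single map `q` invertible, so `p` is isomorphic to `p'`. -/
theorem CylinderClasses.IsFactorizationSystem.E_of_orthogonal {D : Type w} [Category.{v} D]
    {T : CylinderClasses D} (hT : T.IsFactorizationSystem) {I : Type v} [SmallCategory I]
    {A : I ⥤ D} (p : Cocone A)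
    (h : ∀ {J : Type v} [SmallCategory J] {E : J ⥤ D} (q : Cone E), T.M q → Orthogonal p q) :
    T.E p := by
  obtain ⟨V, p', q, hp', hq, e⟩ := hT.factorization
    (Cylinder.ofVertex p.ι (𝟙 ((Functor.const PUnit.{v + 1}).obj p.pt)))
  have e' : ∀ i, p'.app i ≫ q.app ⟨⟩ = p.ι.app i := fun i =>
    ((Cylinder.ofVertex_eq_iff.1 e i ⟨⟩).symm.trans (Category.comp_id _))
  obtain ⟨m, hm, -⟩ := h (Cone.mk V q) hq p' (𝟙 _) e.symm
  have hm₂ : m ≫ q.app ⟨⟩ = 𝟙 _ := hm.2 ⟨⟩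
  -- Both endomorphisms of `V` fill the square formed by `p'` and `q` themselves.
  have hm₁ : q.app ⟨⟩ ≫ m = 𝟙 V :=
    (hT.orthogonal (Cocone.mk V p') (Cone.mk V q) hp' hq p' q rfl).unique
      ⟨fun i => by
        change p'.app i ≫ q.app ⟨⟩ ≫ m = p'.app i
        rw [← Category.assoc, e']
        exact hm.1 i, fun j => by
        change (q.app ⟨⟩ ≫ m) ≫ q.app ⟨⟩ = q.app ⟨⟩
        rw [Category.assoc, hm₂]
        exact Category.comp_id _⟩
      ⟨fun i => Category.comp_id _, fun j => Category.id_comp _⟩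
  have := hT.E_iso (Cocone.mk V p') (⟨q.app ⟨⟩, m, hm₁, hm₂⟩ : V ≅ p.pt) hp'
  convert this
  obtain ⟨X, ι⟩ := p
  refine congrArg (Cocone.mk X) ?_
  ext i
  exact (e' i).symm

theorem CylinderClasses.IsFactorizationSystem.M_of_orthogonal {D : Type w} [Category.{v} D]
    {T : CylinderClasses D} (hT : T.IsFactorizationSystem) {J : Type v} [SmallCategory J]
    {A : J ⥤ D} (q : Cone A)
    (h : ∀ {I : Type v} [SmallCategory I] {E : I ⥤ D} (p : Cocone E), T.E p → Orthogonal p q) :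
    T.M q := by
  obtain ⟨V, p, q', hp, hq', e⟩ := hT.factorization
    (Cylinder.ofVertex (𝟙 ((Functor.const PUnit.{v + 1}).obj q.pt)) q.π)
  have e' : ∀ j, p.app ⟨⟩ ≫ q'.app j = q.π.app j := fun j =>
    ((Cylinder.ofVertex_eq_iff.1 e ⟨⟩ j).symm.trans (Category.id_comp _))
  obtain ⟨m, hm, -⟩ := h (Cocone.mk V p) hp (𝟙 _) q' e
  have hm₁ : p.app ⟨⟩ ≫ m = 𝟙 _ := hm.1 ⟨⟩
  have hm₂ : m ≫ p.app ⟨⟩ = 𝟙 V :=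
    (hT.orthogonal (Cocone.mk V p) (Cone.mk V q') hp hq' p q' rfl).unique
      ⟨fun i => by
        change p.app ⟨⟩ ≫ m ≫ p.app ⟨⟩ = p.app ⟨⟩
        rw [← Category.assoc, hm₁]
        exact Category.id_comp _, fun j => by
        change (m ≫ p.app ⟨⟩) ≫ q'.app j = q'.app j
        rw [Category.assoc, e']
        exact hm.2 j⟩
      ⟨fun i => Category.comp_id _, fun j => Category.id_comp _⟩
  have := hT.M_iso (Cone.mk V q') (⟨p.app ⟨⟩, m, hm₁, hm₂⟩ : q.pt ≅ V) hq'
  convert this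
  obtain ⟨X, π⟩ := q
  refine congrArg (Cone.mk X) ?_
  ext j
  exact (e' j).symm

namespace Envelope

variable {C : Type u} [Category.{v} C] {D : Type w} [Category.{v} D]

/-! ### Cocones and cones indexed by the elements of an object -/

/-- A cocone indexed by the elements of `X⁺`. -/
structure PosData (G : C ⥤ D) (X : Envelope C) (V : D) where
  /-- the legs -/
  leg : ∀ {c : C}, (pos X).obj (op c) → (G.obj c ⟶ V)
  naturality : ∀ {c c' : C} (u : c' ⟶ c) (x : (pos X).obj (op c)),
    leg ((pos X).map u.op x) = G.map u ≫ leg x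

/-- A cone indexed by the elements of `X⁻`. -/
structure NegData (G : C ⥤ D) (X : Envelope C) (V : D) where
  /-- the legs -/
  leg : ∀ {c : C}, (neg X).obj c → (V ⟶ G.obj c)
  naturality : ∀ {c c' : C} (u : c ⟶ c') (y : (neg X).obj c),
    leg ((neg X).map u y) = leg y ≫ G.map u

/-- Postcomposition of a cocone with a morphism. -/
def PosData.postcomp {G : C ⥤ D} {X : Envelope C} {V W : D} (φ : PosData G X V) (m : V ⟶ W) :
    PosData G X W where
  leg x := φ.leg x ≫ m
  naturality u x := by rw [φ.naturality, Category.assoc]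

/-- Precomposition of a cone with a morphism. -/
def NegData.precomp {G : C ⥤ D} {X : Envelope C} {V W : D} (ψ : NegData G X V) (m : W ⟶ V) :
    NegData G X W where
  leg y := m ≫ ψ.leg y
  naturality u y := by rw [ψ.naturality, Category.assoc]

/-- The element of `X⁺` classified by a morphism `Y c ⟶ X`. -/
def posElt {X : Envelope C} {c : C} (f : (Y C).obj c ⟶ X) : (pos X).obj (op c) :=
  (mapPos f).app _ (toPos (𝟙 c))

/-- The element of `X⁻` classified by a morphism `X ⟶ Y c`. -/
def negElt {X : Envelope C} {c : C} (f : X ⟶ (Y C).obj c) : (neg X).obj c :=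
  (mapNeg f).app _ (toNeg (𝟙 c))

theorem ofPos_posElt {X : Envelope C} {c : C} (f : (Y C).obj c ⟶ X) : ofPos (posElt f) = f :=
  (eq_ofPos f).symm

theorem ofNeg_negElt {X : Envelope C} {c : C} (f : X ⟶ (Y C).obj c) : ofNeg (negElt f) = f :=
  (eq_ofNeg f).symm

theorem posElt_ofPos {X : Envelope C} {c : C} (x : (pos X).obj (op c)) :
    posElt (ofPos x) = x :=
  (mapPos_ofPos x (𝟙 c)).trans (by simp)

theorem negElt_ofNeg {X : Envelope C} {c : C} (y : (neg X).obj c) :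
    negElt (ofNeg y) = y :=
  (mapNeg_ofNeg y (𝟙 c)).trans (by simp)

theorem posElt_map_comp {X : Envelope C} {c c' : C} (u : c' ⟶ c) (f : (Y C).obj c ⟶ X) :
    posElt ((Y C).map u ≫ f) = (pos X).map u.op (posElt f) := by
  conv_lhs => rw [← ofPos_posElt f]
  rw [map_comp_ofPos, posElt_ofPos]

theorem negElt_comp_map {X : Envelope C} {c c' : C} (u : c ⟶ c') (f : X ⟶ (Y C).obj c) :
    negElt (f ≫ (Y C).map u) = (neg X).map u (negElt f) := by
  conv_lhs => rw [← ofNeg_negElt f]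
  rw [ofNeg_comp_map, negElt_ofNeg]

theorem mapPos_toPos {X : Envelope C} {c c' : C} (u : c' ⟶ c) (f : (Y C).obj c ⟶ X) :
    (mapPos f).app _ (toPos u) = (pos X).map u.op (posElt f) := by
  conv_lhs => rw [← ofPos_posElt f]
  rw [mapPos_ofPos]

theorem mapNeg_toNeg {X : Envelope C} {c c' : C} (u : c ⟶ c') (f : X ⟶ (Y C).obj c) :
    (mapNeg f).app _ (toNeg u) = (neg X).map u (negElt f) := by
  conv_lhs => rw [← ofNeg_negElt f]
  rw [mapNeg_ofNeg]

/-! ### Generation of the envelope by representables -/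

/-- `(Y c)⁺` is representable, naturally in `c`. -/
def yonedaIsoPos (C : Type u) [Category.{v} C] : CategoryTheory.yoneda ≅ Y C ⋙ posFun C :=
  NatIso.ofComponents (fun c => Iso.refl (CategoryTheory.yoneda.obj c)) fun {c _} u =>
    pos_hom_ext (C := C) (c := c) (mapPos_Y_map u (𝟙 c)).symm

/-- `(Y c)⁻` is corepresentable, naturally in `c`. -/
def coyonedaIsoNeg (C : Type u) [Category.{v} C] : coyoneda ≅ (Y C).op ⋙ negFun C :=
  NatIso.ofComponents (fun c => Iso.refl (coyoneda.obj c)) fun {c _} u =>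
    neg_hom_ext (C := C) (c := c.unop) (mapNeg_Y_map u.unop (𝟙 c.unop)).symm

/-- Every object is the vertex of an `E`-cocone under a small diagram of representables. -/
theorem exists_cocone (X : Envelope C) : ∃ (J : Type v) (_ : SmallCategory J) (K : J ⥤ C)
    (p : K ⋙ Y C ⟶ (Functor.const J).obj X), (classes C).E (Cocone.mk X p) := by
  obtain ⟨J, _, K, p, ⟨hp⟩⟩ := isSmallPresheaf_pos X
  -- The coprojections of the presentation of `X⁺`, read as elements by the Yoneda lemma.
  let x : ∀ j, (pos X).obj (op (K.obj j)) := fun j => (p.app j).app (op (K.obj j)) (𝟙 (K.obj j))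
  have hx : ∀ {j j' : J} (f : j ⟶ j'), (pos X).map (K.map f).op (x j') = x j := by
    intro j j' f
    have h₁ := ConcreteCategory.congr_hom (NatTrans.congr_app (p.naturality f) (op (K.obj j)))
      (𝟙 (K.obj j))
    have h₂ := NatTrans.naturality_apply (p.app j') (K.map f).op (𝟙 (K.obj j'))
    refine h₂.symm.trans (Eq.trans ?_ h₁)
    change (p.app j').app _ (K.map f ≫ 𝟙 _) = (p.app j').app _ (𝟙 _ ≫ K.map f)
    simp
  refine ⟨J, _, K,
    { app := fun j => ofPos (X := X) (x j)
      naturality := fun j j' f => ?_ }, ?_⟩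
  · refine (map_comp_ofPos (K.map f) (x j')).trans (Eq.trans ?_ (Category.comp_id _).symm)
    rw [hx]
  · let e : K ⋙ CategoryTheory.yoneda ≅ (K ⋙ Y C) ⋙ posFun C :=
      Functor.isoWhiskerLeft K (yonedaIsoPos C)
    refine classes_E_iff.2 ⟨((IsColimit.precomposeInvEquiv e _).symm hp).ofIsoColimit
      (Cocone.ext (Iso.refl _) fun j => ?_)⟩
    refine pos_hom_ext (C := C) (c := K.obj j) ?_
    exact (posElt_ofPos (x j)).symm

/-- Every object is the vertex of an `M`-cone over a small diagram of representables. -/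
theorem exists_cone (X : Envelope C) : ∃ (J : Type v) (_ : SmallCategory J) (K : J ⥤ C)
    (q : (Functor.const J).obj X ⟶ K ⋙ Y C), (classes C).M (Cone.mk X q) := by
  obtain ⟨J, _, K, p, ⟨hp⟩⟩ := isSmallCopresheaf_neg X
  let y : ∀ j, (neg X).obj (K.obj j).unop :=
    fun j => (p.app j).app (K.obj j).unop (𝟙 (K.obj j).unop)
  have hy : ∀ {j j' : J} (f : j ⟶ j'), (neg X).map (K.map f).unop (y j') = y j := by
    intro j j' f
    have h₁ := ConcreteCategory.congr_hom (NatTrans.congr_app (p.naturality f) (K.obj j).unop)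
      (𝟙 (K.obj j).unop)
    have h₂ := NatTrans.naturality_apply (p.app j') (K.map f).unop (𝟙 (K.obj j').unop)
    refine h₂.symm.trans (Eq.trans ?_ h₁)
    change (p.app j').app _ (𝟙 _ ≫ (K.map f).unop) = (p.app j').app _ ((K.map f).unop ≫ 𝟙 _)
    simp
  -- The presentation of `X⁻` lives in `Cᵒᵖ`, so the cone in the envelope has shape `Jᵒᵖ`;
  -- `opOpEquivalence` later removes the double opposite.
  refine ⟨Jᵒᵖ, inferInstance, K.leftOp,
    { app := fun j => ofNeg (X := X) (y j.unop)
      naturality := fun j j' f => ?_ }, ?_⟩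
  · refine (Category.id_comp _).trans (Eq.trans ?_
      (ofNeg_comp_map (K.map f.unop).unop (y j.unop)).symm)
    rw [hy]
  · let e : K ⋙ coyoneda ≅ opOp J ⋙ (K.leftOp ⋙ Y C).op ⋙ negFun C :=
      Functor.isoWhiskerLeft K (coyonedaIsoNeg C)
    refine classes_M_iff.2 ⟨IsColimit.ofWhiskerEquivalence (opOpEquivalence J).symm
      (((IsColimit.precomposeInvEquiv e _).symm hp).ofIsoColimit
      (Cocone.ext (Iso.refl _) fun j => ?_))⟩
    refine neg_hom_ext (C := C) (c := (K.obj j).unop) ?_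
    exact (negElt_ofNeg (y j)).symm

/-! ### Families indexed by elements versus small cocones and cones -/

variable {G : C ⥤ D}

section

variable {J : Type v} [SmallCategory J] {K : J ⥤ C} {X : Envelope C}

/-- Such a family is a map from `X⁺` to the presheaf `D(G -, W)`, and `X⁺` is the colimit of the
representables at the `K j`. -/
theorem exists_posData {p : K ⋙ Y C ⟶ (Functor.const J).obj X}
    (hp : (classes C).E (Cocone.mk X p)) {W : D} (h : K ⋙ G ⟶ (Functor.const J).obj W) :
    ∃ χ : PosData G X W, ∀ j, χ.leg (posElt (p.app j)) = h.app j := by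
  obtain ⟨s, hs⟩ := exists_desc_pos hp (Z := G.op ⋙ CategoryTheory.yoneda.obj W)
    (fun j => posDesc (show G.obj (K.obj j) ⟶ W from h.app j))
    (fun {j j'} f => pos_hom_ext (C := C) (c := K.obj j) (by
      refine (congrArg ((posDesc (Z := G.op ⋙ CategoryTheory.yoneda.obj W) (c := K.obj j')
        (h.app j')).app (op (K.obj j))) (mapPos_Y_map (K.map f) (𝟙 _))).trans ?_
      have h₁ : G.map (K.map f) ≫ h.app j' = h.app j :=
        (h.naturality f).trans (Category.comp_id _)
      change G.map (𝟙 _ ≫ K.map f) ≫ h.app j' = G.map (𝟙 _) ≫ h.app j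
      simpa using h₁))
  refine ⟨{ leg := fun {c} x => s.app (op c) x, naturality := fun {c c'} u x => ?_ }, fun j => ?_⟩
  · exact NatTrans.naturality_apply s u.op x
  · refine (ConcreteCategory.congr_hom (CC := fun X => X) (C := Type v) (NatTrans.congr_app (hs j) (op (K.obj j)))
      (toPos (𝟙 (K.obj j)))).trans ?_
    change G.map (𝟙 _) ≫ h.app j = h.app j
    simp

theorem exists_eq_map_posElt {p : K ⋙ Y C ⟶ (Functor.const J).obj X}
    (hp : (classes C).E (Cocone.mk X p)) {c : C} (x : (pos X).obj (op c)) :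
    ∃ (j : J) (u : c ⟶ K.obj j), x = (pos X).map u.op (posElt (p.app j)) := by
  obtain ⟨j, u, hu⟩ := exists_rep_pos hp x
  exact ⟨j, u, hu.symm.trans (mapPos_toPos (show c ⟶ K.obj j from u) (p.app j))⟩

theorem exists_negData {q : (Functor.const J).obj X ⟶ K ⋙ Y C}
    (hq : (classes C).M (Cone.mk X q)) {W : D} (h : (Functor.const J).obj W ⟶ K ⋙ G) :
    ∃ χ : NegData G X W, ∀ j, χ.leg (negElt (q.app j)) = h.app j := by
  obtain ⟨s, hs⟩ := exists_desc_neg hq (Z := G ⋙ coyoneda.obj (op W))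
    (fun j => negDesc (show W ⟶ G.obj (K.obj j) from h.app j))
    (fun {j j'} f => neg_hom_ext (C := C) (c := K.obj j') (by
      refine (congrArg ((negDesc (Z := G ⋙ coyoneda.obj (op W)) (c := K.obj j)
        (h.app j)).app (K.obj j')) (mapNeg_Y_map (K.map f) (𝟙 _))).trans ?_
      have h₁ : h.app j ≫ G.map (K.map f) = h.app j' :=
        (h.naturality f).symm.trans (Category.id_comp _)
      change h.app j ≫ G.map (K.map f ≫ 𝟙 _) = h.app j' ≫ G.map (𝟙 _)
      simpa using h₁))
  refine ⟨{ leg := fun {c} x => s.app c x, naturality := fun {c c'} u x => ?_ }, fun j => ?_⟩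
  · exact NatTrans.naturality_apply s u x
  · refine (ConcreteCategory.congr_hom (CC := fun X => X) (C := Type v) (NatTrans.congr_app (hs j) (K.obj j))
      (toNeg (𝟙 (K.obj j)))).trans ?_
    change h.app j ≫ G.map (𝟙 _) = h.app j
    simp

theorem exists_eq_map_negElt {q : (Functor.const J).obj X ⟶ K ⋙ Y C}
    (hq : (classes C).M (Cone.mk X q)) {c : C} (y : (neg X).obj c) :
    ∃ (j : J) (u : K.obj j ⟶ c), y = (neg X).map u (negElt (q.app j)) := by
  obtain ⟨j, u, hu⟩ := exists_rep_neg hq y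
  exact ⟨j, u, hu.symm.trans (mapNeg_toNeg (show K.obj j ⟶ c from u) (q.app j))⟩

/-- The restriction of `φ` along a small diagram of elements. -/
def PosData.restrict {V : D} (φ : PosData G X V) (p : K ⋙ Y C ⟶ (Functor.const J).obj X) :
    K ⋙ G ⟶ (Functor.const J).obj V where
  app j := φ.leg (posElt (p.app j))
  naturality j j' f := by
    have h : (Y C).map (K.map f) ≫ p.app j' = p.app j :=
      (p.naturality f).trans (Category.comp_id _)
    refine ((φ.naturality (K.map f) (posElt (p.app j'))).symm.trans ?_).trans
      (Category.comp_id _).symm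
    exact congrArg φ.leg ((posElt_map_comp (K.map f) (p.app j')).symm.trans (congrArg posElt h))

/-- The restriction of `ψ` along a small diagram of elements. -/
def NegData.restrict {V : D} (ψ : NegData G X V) (q : (Functor.const J).obj X ⟶ K ⋙ Y C) :
    (Functor.const J).obj V ⟶ K ⋙ G where
  app j := ψ.leg (negElt (q.app j))
  naturality j j' f := by
    have h : q.app j ≫ (Y C).map (K.map f) = q.app j' :=
      (q.naturality f).symm.trans (Category.id_comp _)
    refine (Category.id_comp _).trans (Eq.trans ?_ (ψ.naturality (K.map f) (negElt (q.app j))))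
    exact congrArg ψ.leg ((congrArg negElt h).symm.trans (negElt_comp_map (K.map f) (q.app j)))

end

/-- `φ` restricts to a cocone in `T.E` along some small colimiting diagram of elements. -/
def PosData.IsE (T : CylinderClasses D) {X : Envelope C} {V : D} (φ : PosData G X V) : Prop :=
  ∃ (J : Type v) (_ : SmallCategory J) (K : J ⥤ C) (p : K ⋙ Y C ⟶ (Functor.const J).obj X),
    (classes C).E (Cocone.mk X p) ∧ T.E (Cocone.mk V (φ.restrict p))

/-- `ψ` restricts to a cone in `T.M` along some small limiting diagram of elements. -/
def NegData.IsM (T : CylinderClasses D) {X : Envelope C} {V : D} (ψ : NegData G X V) : Prop :=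
  ∃ (J : Type v) (_ : SmallCategory J) (K : J ⥤ C) (q : (Functor.const J).obj X ⟶ K ⋙ Y C),
    (classes C).M (Cone.mk X q) ∧ T.M (Cone.mk V (ψ.restrict q))

variable {T : CylinderClasses D}

/-- The category of elements of `X⁺` may be large, so the orthogonality axiom applies only to a
small diagram inside it. Every element is a translate of one from the diagram, so naturality carries
the equations over. -/
theorem PosData.IsE.lift (hT : T.IsFactorizationSystem) {X : Envelope C} {V : D}
    {φ : PosData G X V} (hφ : φ.IsE T) {J : Type v} [SmallCategory J] {E : J ⥤ D} {q : Cone E}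
    (hq : T.M q) (χ : PosData G X q.pt) (k : (Functor.const J).obj V ⟶ E)
    (H : ∀ {c : C} (x : (pos X).obj (op c)) (j : J),
      χ.leg x ≫ q.π.app j = φ.leg x ≫ (k.app j : V ⟶ E.obj j)) :
    ∃! m : V ⟶ q.pt, (∀ {c : C} (x : (pos X).obj (op c)), φ.leg x ≫ m = χ.leg x) ∧
      ∀ j, m ≫ q.π.app j = k.app j := by
  obtain ⟨I, _, K, p, hp, hφ⟩ := hφ
  obtain ⟨m, hm, hu⟩ := hT.orthogonal _ q hφ hq (χ.restrict p) k
    (Cylinder.ofVertex_eq_iff.2 fun i j => H _ j)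
  refine ⟨m, ⟨fun {c} x => ?_, hm.2⟩, fun m' hm' => hu m' ⟨fun i => hm'.1 _, hm'.2⟩⟩
  obtain ⟨i, u, rfl⟩ := exists_eq_map_posElt hp x
  have := hm.1 i
  rw [φ.naturality, χ.naturality, Category.assoc]
  exact congrArg _ this

theorem NegData.IsM.lift (hT : T.IsFactorizationSystem) {X : Envelope C} {V : D}
    {ψ : NegData G X V} (hψ : ψ.IsM T) {I : Type v} [SmallCategory I] {E : I ⥤ D} {p : Cocone E}
    (hp : T.E p) (χ : NegData G X p.pt) (h : E ⟶ (Functor.const I).obj V)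
    (H : ∀ {c : C} (y : (neg X).obj c) (i : I),
      (h.app i : E.obj i ⟶ V) ≫ ψ.leg y = p.ι.app i ≫ χ.leg y) :
    ∃! m : p.pt ⟶ V, (∀ i, p.ι.app i ≫ m = h.app i) ∧
      ∀ {c : C} (y : (neg X).obj c), m ≫ ψ.leg y = χ.leg y := by
  obtain ⟨J, _, K, q, hq, hψ⟩ := hψ
  obtain ⟨m, hm, hu⟩ := hT.orthogonal p _ hp hψ h (χ.restrict q)
    (Cylinder.ofVertex_eq_iff.2 fun i j => H _ i)
  refine ⟨m, ⟨hm.1, fun {c} y => ?_⟩, fun m' hm' => hu m' ⟨hm'.1, fun j => hm'.2 _⟩⟩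
  obtain ⟨j, u, rfl⟩ := exists_eq_map_negElt hq y
  have := hm.2 j
  rw [ψ.naturality, χ.naturality, ← Category.assoc]
  exact congrArg (· ≫ _) this

/-- Two functors `G` and `G'` are allowed so that the same filler serves transformations between two
functors and the action of one extension on morphisms. -/
theorem PosData.IsE.existsUnique_fill (hT : T.IsFactorizationSystem) {G' : C ⥤ D}
    {X X' : Envelope C} {V V' : D}
    {φ : PosData G X V} (hφ : φ.IsE T) {ψ : NegData G' X' V'} (hψ : ψ.IsM T)
    (χ : PosData G X V') (κ : NegData G' X' V)
    (H : ∀ {a b : C} (x : (pos X).obj (op a)) (y : (neg X').obj b),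
      χ.leg x ≫ ψ.leg y = φ.leg x ≫ κ.leg y) :
    ∃! m : V ⟶ V', (∀ {c : C} (x : (pos X).obj (op c)), φ.leg x ≫ m = χ.leg x) ∧
      ∀ {c : C} (y : (neg X').obj c), m ≫ ψ.leg y = κ.leg y := by
  obtain ⟨J, _, K, q, hq, hψ⟩ := hψ
  obtain ⟨m, hm, hu⟩ := hφ.lift hT hψ χ (κ.restrict q) (fun x j => H x _)
  refine ⟨m, ⟨hm.1, fun {c} y => ?_⟩, fun m' hm' => hu m' ⟨hm'.1, fun j => hm'.2 _⟩⟩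
  obtain ⟨j, u, rfl⟩ := exists_eq_map_negElt hq y
  have := hm.2 j
  rw [ψ.naturality, κ.naturality, ← Category.assoc]
  exact congrArg (· ≫ _) this

end Envelope

namespace Envelope

variable {C : Type u} [Category.{v} C] {D : Type w} [Category.{v} D]

/-! ### Restriction along `Y` is fully faithful -/

/-- The cocone of the images under `F` of all morphisms from representables to `X`. -/
def PosData.ofFunctor (F : Envelope C ⥤ D) (X : Envelope C) : PosData (Y C ⋙ F) X (F.obj X) where
  leg x := F.map (ofPos x)
  naturality u x := by
    rw [← map_comp_ofPos, F.map_comp]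
    rfl

/-- The cone of the images under `F` of all morphisms from `X` to representables. -/
def NegData.ofFunctor (F : Envelope C ⥤ D) (X : Envelope C) : NegData (Y C ⋙ F) X (F.obj X) where
  leg y := F.map (ofNeg y)
  naturality u y := by
    rw [← ofNeg_comp_map, F.map_comp]
    rfl

variable {T : CylinderClasses D}

/-- This is where preservation of `E` enters: `F` is applied to the generating cocone of `X`. -/
theorem PosData.isE_ofFunctor {F : Envelope C ⥤ D} (hF : preservesClasses (classes C) T F)
    (X : Envelope C) : (PosData.ofFunctor F X).IsE T := by
  obtain ⟨J, _, K, p, hp⟩ := exists_cocone X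
  refine ⟨J, _, K, p, hp, ?_⟩
  have e : (PosData.ofFunctor F X).restrict p = (F.mapCocone (Cocone.mk X p)).ι :=
    NatTrans.ext (funext fun j => congrArg F.map (ofPos_posElt (p.app j)))
  rw [e]
  exact hF.1 _ hp

theorem NegData.isM_ofFunctor {F : Envelope C ⥤ D} (hF : preservesClasses (classes C) T F)
    (X : Envelope C) : (NegData.ofFunctor F X).IsM T := by
  obtain ⟨J, _, K, q, hq⟩ := exists_cone X
  refine ⟨J, _, K, q, hq, ?_⟩
  have e : (NegData.ofFunctor F X).restrict q = (F.mapCone (Cone.mk X q)).π :=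
    NatTrans.ext (funext fun j => congrArg F.map (ofNeg_negElt (q.app j)))
  rw [e]
  exact hF.2 _ hq

/-- Stated for an arbitrary `f`: the case `f = 𝟙 X` defines the component at `X`, and the general
case proves naturality, since both composites around the square are fillers. Compatibility is
naturality of `α` at `ξ(y, f⁺ x)`. -/
theorem existsUnique_extend_app (hT : T.IsFactorizationSystem) {F F' : Envelope C ⥤ D}
    (hF : preservesClasses (classes C) T F) (hF' : preservesClasses (classes C) T F')
    (α : Y C ⋙ F ⟶ Y C ⋙ F') (X X' : Envelope C) (f : X ⟶ X') :
    ∃! m : F.obj X ⟶ F'.obj X',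
      (∀ {c : C} (x : (pos X).obj (op c)),
        F.map (ofPos x) ≫ m = α.app c ≫ F'.map (ofPos x ≫ f)) ∧
      ∀ {c : C} (y : (neg X').obj c), m ≫ F'.map (ofNeg y) = F.map (f ≫ ofNeg y) ≫ α.app c :=
  (PosData.isE_ofFunctor hF X).existsUnique_fill hT (NegData.isM_ofFunctor hF' X')
    { leg := fun {c} x => α.app c ≫ F'.map (ofPos x ≫ f)
      naturality := fun u x => by
        have h := α.naturality u
        rw [← map_comp_ofPos, Category.assoc, F'.map_comp, ← Category.assoc, ← Category.assoc]
        exact congrArg (· ≫ _) h.symm }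
    { leg := fun {c} y => F.map (f ≫ ofNeg y) ≫ α.app c
      naturality := fun u y => by
        have h := α.naturality u
        rw [← ofNeg_comp_map, ← Category.assoc, F.map_comp, Category.assoc, Category.assoc]
        exact congrArg (_ ≫ ·) h }
    (fun {a b} x y => by
      have h := α.naturality (pair X' y ((mapPos f).app _ x))
      change F.map ((Y C).map _) ≫ α.app b = α.app a ≫ F'.map ((Y C).map _) at h
      rw [← ofPos_comp_ofNeg, ← ofPos_comp, Category.assoc] at h
      change (α.app a ≫ F'.map (ofPos x ≫ f)) ≫ F'.map (ofNeg y) =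
        F.map (ofPos x) ≫ F.map (f ≫ ofNeg y) ≫ α.app b
      rw [← Category.assoc (F.map _), ← F.map_comp, h, Category.assoc, ← F'.map_comp,
        Category.assoc])

theorem faithful_restrict (hT : T.IsFactorizationSystem) : (restrict C T).Faithful where
  map_injective {F F'} α β h := by
    refine ObjectProperty.hom_ext _ (NatTrans.ext (funext fun X => ?_))
    refine (existsUnique_extend_app hT F.property F'.property ((restrict C T).map α) X X
      (𝟙 X)).unique ⟨fun x => ?_, fun y => ?_⟩ ⟨fun x => ?_, fun y => ?_⟩
    · rw [Category.comp_id]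
      exact α.hom.naturality _
    · rw [Category.id_comp]
      exact (α.hom.naturality _).symm
    · rw [Category.comp_id, h]
      exact β.hom.naturality _
    · rw [Category.id_comp, h]
      exact (β.hom.naturality _).symm

theorem full_restrict (hT : T.IsFactorizationSystem) : (restrict C T).Full where
  map_surjective {F F'} α := by
    change Y C ⋙ F.obj ⟶ Y C ⋙ F'.obj at α
    have ex := existsUnique_extend_app hT F.property F'.property α
    choose m hm using fun X => (ex X X (𝟙 X)).exists
    have h₁ : ∀ {X : Envelope C} {c : C} (g : (Y C).obj c ⟶ X),
        F.obj.map g ≫ m X = α.app c ≫ F'.obj.map g := fun {X c} g => by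
      rw [← ofPos_posElt g, (hm X).1, Category.comp_id]
    have h₂ : ∀ {X : Envelope C} {c : C} (g : X ⟶ (Y C).obj c),
        m X ≫ F'.obj.map g = F.obj.map g ≫ α.app c := fun {X c} g => by
      rw [← ofNeg_negElt g, (hm X).2, Category.id_comp]
    refine ⟨ObjectProperty.homMk { app := m, naturality := fun X X' f => ?_ }, ?_⟩
    · refine (ex X X' f).unique ⟨fun x => ?_, fun y => ?_⟩ ⟨fun x => ?_, fun y => ?_⟩
      · rw [← Category.assoc, ← F.obj.map_comp, h₁]
      · rw [Category.assoc, h₂, ← Category.assoc, F.obj.map_comp]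
      · rw [← Category.assoc, h₁, Category.assoc, F'.obj.map_comp]
      · rw [Category.assoc, ← F'.obj.map_comp, h₂]
    · ext c
      have := h₁ (𝟙 ((Y C).obj c))
      rw [F.obj.map_id, F'.obj.map_id, Category.id_comp] at this
      exact this.trans (Category.comp_id _)

/-! ### Restriction along `Y` is essentially surjective -/

/-- The value at `X` must factor the image under `G` of the cylinder of which `X` is the formal
vertex. -/
theorem exists_extension_obj (hT : T.IsFactorizationSystem) (G : C ⥤ D) (X : Envelope C) :
    ∃ (V : D) (φ : PosData G X V) (ψ : NegData G X V), φ.IsE T ∧ ψ.IsM T ∧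
      ∀ {a b : C} (x : (pos X).obj (op a)) (y : (neg X).obj b),
        φ.leg x ≫ ψ.leg y = G.map (pair X y x) := by
  obtain ⟨I, _, K, p, hp⟩ := exists_cocone X
  obtain ⟨J, _, L, q, hq⟩ := exists_cone X
  -- The composites `Y (K i) ⟶ X ⟶ Y (L j)` are maps of `C` given by `ξ`, so `G` can be applied to
  -- them.
  let r : Cylinder (K ⋙ G) (L ⋙ G) :=
    { app := fun ij => G.map (pair X (negElt (q.app ij.2)) (posElt (p.app ij.1)))
      naturality := fun ij ij' f => by
        have h₁ : (Y C).map (K.map f.1) ≫ p.app ij'.1 = p.app ij.1 :=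
          (p.naturality f.1).trans (Category.comp_id _)
        have h₂ : q.app ij.2 ≫ (Y C).map (L.map f.2) = q.app ij'.2 :=
          (q.naturality f.2).symm.trans (Category.id_comp _)
        refine (G.map_comp _ _).symm.trans (Eq.trans (congrArg G.map ?_) (G.map_comp _ _))
        erw [← pair_map_pos, ← pair_map_neg, ← posElt_map_comp, ← negElt_comp_map, h₁, h₂] }
  obtain ⟨V, p', q', hp', hq', e⟩ := hT.factorization r
  obtain ⟨φ, hφ⟩ := exists_posData hp p'
  obtain ⟨ψ, hψ⟩ := exists_negData hq q'
  refine ⟨V, φ, ψ, ⟨I, _, K, p, hp, ?_⟩, ⟨J, _, L, q, hq, ?_⟩, fun x y => ?_⟩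
  · have : φ.restrict p = p' := NatTrans.ext (funext hφ)
    rwa [this]
  · have : ψ.restrict q = q' := NatTrans.ext (funext hψ)
    rwa [this]
  · obtain ⟨i, u, rfl⟩ := exists_eq_map_posElt hp x
    obtain ⟨j, t, rfl⟩ := exists_eq_map_negElt hq y
    have := NatTrans.congr_app e (i, j)
    rw [φ.naturality, ψ.naturality, hφ, hψ, pair_map, G.map_comp, G.map_comp]
    rw [Category.assoc, ← Category.assoc (p'.app i)]
    exact congrArg (fun k => G.map u ≫ k ≫ G.map t) this.symm

/-- A choice of an extension of `G` along `Y` on objects. -/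
structure ObjExtension (T : CylinderClasses D) (G : C ⥤ D) (X : Envelope C) where
  /-- the value at `X` -/
  pt : D
  /-- the cocone of images of elements of `X⁺` -/
  φ : PosData G X pt
  /-- the cone of images of elements of `X⁻` -/
  ψ : NegData G X pt
  isE : φ.IsE T
  isM : ψ.IsM T
  comp_eq : ∀ {a b : C} (x : (pos X).obj (op a)) (y : (neg X).obj b),
    φ.leg x ≫ ψ.leg y = G.map (pair X y x)

namespace ObjExtension

variable {G : C ⥤ D}

theorem existsUnique_map (hT : T.IsFactorizationSystem) {X X' : Envelope C}
    (A : ObjExtension T G X) (A' : ObjExtension T G X') (f : X ⟶ X') :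
    ∃! m : A.pt ⟶ A'.pt,
      (∀ {c : C} (x : (pos X).obj (op c)), A.φ.leg x ≫ m = A'.φ.leg ((mapPos f).app _ x)) ∧
      ∀ {c : C} (y : (neg X').obj c), m ≫ A'.ψ.leg y = A.ψ.leg ((mapNeg f).app _ y) :=
  A.isE.existsUnique_fill hT A'.isM
    { leg := fun x => A'.φ.leg ((mapPos f).app _ x)
      naturality := fun u x => by rw [NatTrans.naturality_apply, A'.φ.naturality] }
    { leg := fun y => A.ψ.leg ((mapNeg f).app _ y)
      naturality := fun u y => by rw [NatTrans.naturality_apply, A.ψ.naturality] }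
    (fun x y => by
      change A'.φ.leg _ ≫ A'.ψ.leg y = A.φ.leg x ≫ A.ψ.leg _
      rw [A.comp_eq, A'.comp_eq, pair_mapPos])

variable (hT : T.IsFactorizationSystem) (A : ∀ X, ObjExtension T G X)

/-- The extension of `G` along `Y`. -/
def functor : Envelope C ⥤ D where
  obj X := (A X).pt
  map {X X'} f := (existsUnique_map hT (A X) (A X') f).choose
  map_id X := (existsUnique_map hT (A X) (A X) (𝟙 X)).unique
    (existsUnique_map hT (A X) (A X) (𝟙 X)).choose_spec.1
    ⟨fun x => by rw [mapPos_id_apply, Category.comp_id],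
      fun y => by rw [mapNeg_id_apply, Category.id_comp]⟩
  map_comp {X X' X''} f g := (existsUnique_map hT (A X) (A X'') (f ≫ g)).unique
    (existsUnique_map hT (A X) (A X'') (f ≫ g)).choose_spec.1
    ⟨fun x => by
      rw [mapPos_comp_apply, ← Category.assoc,
        (existsUnique_map hT (A X) (A X') f).choose_spec.1.1,
        (existsUnique_map hT (A X') (A X'') g).choose_spec.1.1],
      fun y => by
      rw [mapNeg_comp_apply, Category.assoc,
        (existsUnique_map hT (A X') (A X'') g).choose_spec.1.2,
        (existsUnique_map hT (A X) (A X') f).choose_spec.1.2]⟩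

theorem leg_comp_map {X X' : Envelope C} (f : X ⟶ X') {c : C} (x : (pos X).obj (op c)) :
    (A X).φ.leg x ≫ (functor hT A).map f = (A X').φ.leg ((mapPos f).app _ x) :=
  (existsUnique_map hT (A X) (A X') f).choose_spec.1.1 x

theorem map_comp_leg {X X' : Envelope C} (f : X ⟶ X') {c : C} (y : (neg X').obj c) :
    (functor hT A).map f ≫ (A X').ψ.leg y = (A X).ψ.leg ((mapNeg f).app _ y) :=
  (existsUnique_map hT (A X) (A X') f).choose_spec.1.2 y

theorem pos_map_pair {a c : C} (x : (pos ((Y C).obj c)).obj (op a)) :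
    (pos ((Y C).obj c)).map (pair ((Y C).obj c) (toNeg (𝟙 c)) x).op (toPos (𝟙 c)) = x :=
  ((Category.comp_id _).trans (Category.comp_id _) : (x ≫ 𝟙 c) ≫ 𝟙 c = (x : a ⟶ c))

theorem neg_map_pair {b c : C} (y : (neg ((Y C).obj c)).obj b) :
    (neg ((Y C).obj c)).map (pair ((Y C).obj c) y (toPos (𝟙 c))) (toNeg (𝟙 c)) = y :=
  ((Category.id_comp _).trans (Category.id_comp _) : 𝟙 c ≫ 𝟙 c ≫ y = (y : c ⟶ b))

/-- The extension restricts to `G`. -/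
def restrictIso : Y C ⋙ functor hT A ≅ G :=
  NatIso.ofComponents (fun c =>
    { hom := (A ((Y C).obj c)).ψ.leg (toNeg (𝟙 c))
      inv := (A ((Y C).obj c)).φ.leg (toPos (𝟙 c))
      -- By uniqueness of fillers: the composite acts as the identity on all legs, each being `G` of
      -- a map of `C` composed with the leg at `𝟙 c`.
      hom_inv_id := by
        refine (existsUnique_map hT (A ((Y C).obj c)) (A ((Y C).obj c)) (𝟙 _)).unique
          ⟨fun {a} x => ?_, fun {b} y => ?_⟩
          ⟨fun x => by rw [mapPos_id_apply]; exact Category.comp_id _,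
            fun y => by rw [mapNeg_id_apply]; exact Category.id_comp _⟩
        · rw [mapPos_id_apply]
          refine (Category.assoc _ _ _).symm.trans ?_
          refine (congrArg (· ≫ _) ((A ((Y C).obj c)).comp_eq x (toNeg (𝟙 c)))).trans ?_
          refine ((A ((Y C).obj c)).φ.naturality _ _).symm.trans ?_
          rw [pos_map_pair]
        · rw [mapNeg_id_apply]
          refine (Category.assoc _ _ _).trans ?_
          refine (congrArg (_ ≫ ·) ((A ((Y C).obj c)).comp_eq (toPos (𝟙 c)) y)).trans ?_
          refine ((A ((Y C).obj c)).ψ.naturality _ _).symm.trans ?_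
          rw [neg_map_pair]
      inv_hom_id := by
        refine ((A ((Y C).obj c)).comp_eq _ _).trans ?_
        rw [pair_toNeg_toPos, Category.comp_id, G.map_id] })
    (fun {c c'} u => by
      refine (map_comp_leg hT A ((Y C).map u) (toNeg (𝟙 c'))).trans ?_
      refine Eq.trans ?_ ((A ((Y C).obj c)).ψ.naturality u (toNeg (𝟙 c)))
      rw [mapNeg_Y_map, neg_map_toNeg, Category.comp_id, Category.id_comp])

end ObjExtension

/-! ### Gluing of families, and preservation of the classes by the extension -/

theorem PosData.exists_desc {G : C ⥤ D} {I : Type v} [SmallCategory I] {B : I ⥤ Envelope C}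
    {p : Cocone B} (hp : (classes C).E p) {W : D} (t : ∀ i, PosData G (B.obj i) W)
    (ht : ∀ {i i' : I} (f : i ⟶ i') {c : C} (x : (pos (B.obj i)).obj (op c)),
      (t i').leg ((mapPos (B.map f)).app _ x) = (t i).leg x) :
    ∃ χ : PosData G p.pt W, ∀ (i : I) {c : C} (x : (pos (B.obj i)).obj (op c)),
      χ.leg ((mapPos (p.ι.app i)).app _ x) = (t i).leg x := by
  obtain ⟨s, hs⟩ := exists_desc_pos hp (Z := G.op ⋙ CategoryTheory.yoneda.obj W)
    (fun i =>
      { app := fun c => ↾fun x => (t i).leg (show (pos (B.obj i)).obj (op c.unop) from x)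
        naturality := fun c c' u => by
          ext x
          exact (t i).naturality u.unop _ })
    (fun f => by
      ext c x
      exact ht f (show (pos (B.obj _)).obj (op c.unop) from x))
  exact ⟨{ leg := fun {c} x => s.app (op c) x
           naturality := fun u x => NatTrans.naturality_apply s u.op x },
    fun i {c} x => ConcreteCategory.congr_hom (NatTrans.congr_app (hs i) (op c)) x⟩

theorem NegData.exists_desc {G : C ⥤ D} {J : Type v} [SmallCategory J] {B : J ⥤ Envelope C}
    {q : Cone B} (hq : (classes C).M q) {W : D} (t : ∀ j, NegData G (B.obj j) W)
    (ht : ∀ {j j' : J} (f : j ⟶ j') {c : C} (y : (neg (B.obj j')).obj c),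
      (t j).leg ((mapNeg (B.map f)).app _ y) = (t j').leg y) :
    ∃ χ : NegData G q.pt W, ∀ (j : J) {c : C} (y : (neg (B.obj j)).obj c),
      χ.leg ((mapNeg (q.π.app j)).app _ y) = (t j).leg y := by
  obtain ⟨s, hs⟩ := exists_desc_neg hq (Z := G ⋙ coyoneda.obj (op W))
    (fun j =>
      { app := fun c => ↾fun y => (t j).leg y
        naturality := fun c c' u => by
          ext y
          exact (t j).naturality u _ })
    (fun f => by
      ext c y
      exact ht f y)
  exact ⟨{ leg := fun {c} y => s.app c y
           naturality := fun u y => NatTrans.naturality_apply s u y },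
    fun j {c} y => ConcreteCategory.congr_hom (NatTrans.congr_app (hs j) c) y⟩

namespace ObjExtension

variable {G : C ⥤ D} (hT : T.IsFactorizationSystem) (A : ∀ X, ObjExtension T G X)

/-- It suffices to check orthogonality to every `M`-cone. Since the vertex of `p` has positive part
the colimit of the `B i⁺`, the maps `h i` restricted to elements glue to one family, which lifts
through the value at the vertex. -/
theorem E_functor_mapCocone {I : Type v} [SmallCategory I] {B : I ⥤ Envelope C} (p : Cocone B)
    (hp : (classes C).E p) : T.E ((functor hT A).mapCocone p) := by
  refine hT.E_of_orthogonal _ fun {J} _ E q hq h k H => ?_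
  have h_nat : ∀ {i i' : I} (f : i ⟶ i'), (functor hT A).map (B.map f) ≫ h.app i' = h.app i :=
    fun f => (h.naturality f).trans (Category.comp_id _)
  replace H : ∀ i j, h.app i ≫ q.π.app j = (functor hT A).map (p.ι.app i) ≫ k.app j :=
    Cylinder.ofVertex_eq_iff.1 H
  obtain ⟨χ, hχ⟩ := PosData.exists_desc (G := G) (W := q.pt) hp
    (fun i => (A (B.obj i)).φ.postcomp (h.app i))
    (fun {i i'} f {c} x => by
      change (A (B.obj i')).φ.leg _ ≫ h.app i' = (A (B.obj i)).φ.leg x ≫ h.app i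
      rw [← leg_comp_map hT]
      exact (Category.assoc _ _ _).trans (congrArg (_ ≫ ·) (h_nat f)))
  have key : ∀ (i : I) {c : C} (x : (pos (B.obj i)).obj (op c)) {W : D}
      (m : (functor hT A).obj p.pt ⟶ W),
      (A p.pt).φ.leg ((mapPos (p.ι.app i)).app _ x) ≫ m =
        (A (B.obj i)).φ.leg x ≫ (functor hT A).map (p.ι.app i) ≫ m := fun i c x W m => by
    rw [← leg_comp_map hT]
    exact Category.assoc _ _ _
  obtain ⟨m, hm, hu⟩ := (A p.pt).isE.lift hT hq χ k (fun x j => by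
    obtain ⟨i, x, rfl⟩ := exists_rep_pos hp x
    rw [hχ]
    refine (Category.assoc _ _ _).trans (Eq.trans ?_ (key i x _).symm)
    exact congrArg (_ ≫ ·) (H i j))
  refine ⟨m, ⟨fun i => ?_, hm.2⟩, fun m' hm' => hu m' ⟨fun {c} x => ?_, hm'.2⟩⟩
  -- Elements only show that the two maps agree after the legs of `φ`, which need not be jointly
  -- epimorphic; agreement with the legs of `q` as well gives equality.
  · refine ((A (B.obj i)).isE.lift hT hq
      ((A (B.obj i)).φ.postcomp (h.app i))
      ((Functor.const J).map ((functor hT A).map (p.ι.app i)) ≫ k)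
      (fun x j => (Category.assoc _ _ _).trans (congrArg (_ ≫ ·) (H i j)))).unique
      ⟨fun x => ?_, fun j => ?_⟩ ⟨fun x => rfl, fun j => H i j⟩
    · exact ((key i x m).symm.trans (hm.1 _)).trans (hχ i x)
    · exact (Category.assoc _ _ _).trans (congrArg (_ ≫ ·) (hm.2 j))
  · obtain ⟨i, x, rfl⟩ := exists_rep_pos hp x
    rw [hχ]
    exact (key i x m').trans (congrArg (_ ≫ ·) (hm'.1 i))

theorem M_functor_mapCone {J : Type v} [SmallCategory J] {B : J ⥤ Envelope C} (q : Cone B)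
    (hq : (classes C).M q) : T.M ((functor hT A).mapCone q) := by
  refine hT.M_of_orthogonal _ fun {I} _ E p hp h k H => ?_
  have k_nat : ∀ {j j' : J} (f : j ⟶ j'), k.app j ≫ (functor hT A).map (B.map f) = k.app j' :=
    fun f => (k.naturality f).symm.trans (Category.id_comp _)
  replace H : ∀ i j, h.app i ≫ (functor hT A).map (q.π.app j) = p.ι.app i ≫ k.app j :=
    Cylinder.ofVertex_eq_iff.1 H
  obtain ⟨χ, hχ⟩ := NegData.exists_desc (G := G) (W := p.pt) hq
    (fun j => (A (B.obj j)).ψ.precomp (k.app j))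
    (fun {j j'} f {c} y => by
      change k.app j ≫ (A (B.obj j)).ψ.leg _ = k.app j' ≫ (A (B.obj j')).ψ.leg y
      rw [← map_comp_leg hT]
      exact (Category.assoc _ _ _).symm.trans (congrArg (· ≫ _) (k_nat f)))
  have key : ∀ (j : J) {c : C} (y : (neg (B.obj j)).obj c) {W : D}
      (m : W ⟶ (functor hT A).obj q.pt),
      m ≫ (A q.pt).ψ.leg ((mapNeg (q.π.app j)).app _ y) =
        (m ≫ (functor hT A).map (q.π.app j)) ≫ (A (B.obj j)).ψ.leg y := fun j c y W m => by
    rw [← map_comp_leg hT]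
    exact (Category.assoc _ _ _).symm
  obtain ⟨m, hm, hu⟩ := (A q.pt).isM.lift hT hp χ h (fun y i => by
    obtain ⟨j, y, rfl⟩ := exists_rep_neg hq y
    rw [hχ]
    refine (key j y _).trans (Eq.trans ?_ (Category.assoc _ _ _))
    exact congrArg (· ≫ _) (H i j))
  refine ⟨m, ⟨hm.1, fun j => ?_⟩, fun m' hm' => hu m' ⟨hm'.1, fun {c} y => ?_⟩⟩
  · refine ((A (B.obj j)).isM.lift hT hp
      ((A (B.obj j)).ψ.precomp (k.app j))
      (h ≫ (Functor.const I).map ((functor hT A).map (q.π.app j)))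
      (fun y i => (congrArg (· ≫ _) (H i j)).trans (Category.assoc _ _ _))).unique
      ⟨fun i => ?_, fun y => ?_⟩ ⟨fun i => (H i j).symm, fun y => rfl⟩
    · exact (Category.assoc _ _ _).symm.trans (congrArg (· ≫ _) (hm.1 i))
    · exact ((key j y m).symm.trans (hm.2 _)).trans (hχ j y)
  · obtain ⟨j, y, rfl⟩ := exists_rep_neg hq y
    rw [hχ]
    exact (key j y m').trans (congrArg (· ≫ _) (hm'.2 j))

theorem functor_preservesClasses : preservesClasses (classes C) T (functor hT A) :=
  ⟨E_functor_mapCocone hT A, M_functor_mapCone hT A⟩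

end ObjExtension

theorem essSurj_restrict (hT : T.IsFactorizationSystem) : (restrict C T).EssSurj where
  mem_essImage G := by
    choose V φ ψ h₁ h₂ h₃ using exists_extension_obj (C := C) hT G
    let A : ∀ X, ObjExtension T G X := fun X => ⟨V X, φ X, ψ X, h₁ X, h₂ X, h₃ X⟩
    exact ⟨⟨ObjExtension.functor hT A, ObjExtension.functor_preservesClasses hT A⟩,
      ⟨ObjExtension.restrictIso hT A⟩⟩

theorem isEquivalence_restrict (hT : T.IsFactorizationSystem) : (restrict C T).IsEquivalence where
  faithful := faithful_restrict hT
  full := full_restrict hT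
  essSurj := essSurj_restrict hT

end Envelope

namespace Envelope

/-! ### The left biadjoint -/

/-- `ℐ C` with its cylinder factorisation system. -/
def freeCFS (C : Cat.{v, max u (v + 1)}) : CFS.{v, max u (v + 1)} :=
  toCFS C (isFactorizationSystem_classes C)

variable {A B : Cat.{v, max u (v + 1)}}

/-- The Yoneda embedding into the free cylinder factorisation system. -/
def unit (A : Cat.{v, max u (v + 1)}) : A ⥤ (freeCFS.{v, u} A).carrier := Y A

/-- Restriction along the unit. -/
def restrictUnit (A : Cat.{v, max u (v + 1)}) (X : CFS.{v, max u (v + 1)}) :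
    (freeCFS.{v, u} A ⟶ X) ⥤ (A ⥤ X.carrier) :=
  restrict A X.classes

instance (A : Cat.{v, max u (v + 1)}) (X : CFS.{v, max u (v + 1)}) :
    (restrictUnit.{v, u} A X).IsEquivalence :=
  isEquivalence_restrict X.isFactorizationSystem

/-- Faithfulness of restriction, in the form that reduces the pseudofunctor laws to components at
representables. -/
theorem hom₂_ext_unit {X : CFS.{v, max u (v + 1)}} {S T : freeCFS.{v, u} A ⟶ X} {α β : S ⟶ T}
    (h : ∀ c : A, α.hom.app ((unit A).obj c) = β.hom.app ((unit A).obj c)) : α = β :=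
  (restrictUnit A X).map_injective (NatTrans.ext (funext h))

/-- Extension of isomorphisms along the unit. -/
def extendIso {X : CFS.{v, max u (v + 1)}} {S T : freeCFS.{v, u} A ⟶ X}
    (α : unit A ⋙ S.obj ≅ unit A ⋙ T.obj) : S ≅ T :=
  (restrictUnit A X).preimageIso α

/-- Extension of transformations along the unit. -/
def extendHom {X : CFS.{v, max u (v + 1)}} {S T : freeCFS.{v, u} A ⟶ X}
    (α : unit A ⋙ S.obj ⟶ unit A ⋙ T.obj) : S ⟶ T :=
  (restrictUnit A X).preimage α

theorem extendHom_app {X : CFS.{v, max u (v + 1)}} {S T : freeCFS.{v, u} A ⟶ X}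
    (α : unit A ⋙ S.obj ⟶ unit A ⋙ T.obj) (c : A) :
    (extendHom α).hom.app ((unit A).obj c) = α.app c :=
  NatTrans.congr_app ((restrictUnit A X).map_preimage α) c

theorem extendIso_hom_app {X : CFS.{v, max u (v + 1)}} {S T : freeCFS.{v, u} A ⟶ X}
    (α : unit A ⋙ S.obj ≅ unit A ⋙ T.obj) (c : A) :
    (extendIso α).hom.hom.app ((unit A).obj c) = α.hom.app c :=
  extendHom_app α.hom c

theorem extendIso_inv_app {X : CFS.{v, max u (v + 1)}} {S T : freeCFS.{v, u} A ⟶ X}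
    (α : unit A ⋙ S.obj ≅ unit A ⋙ T.obj) (c : A) :
    (extendIso α).inv.hom.app ((unit A).obj c) = α.inv.app c :=
  extendHom_app α.inv c

/-- The action of `ℐ` on functors. -/
def freeMap (F : A ⟶ B) : freeCFS.{v, u} A ⟶ freeCFS.{v, u} B :=
  (restrictUnit A (freeCFS B)).objPreimage (F.toFunctor ⋙ unit B)

/-- The action of `ℐ` on functors extends the given functor. -/
def freeMapIso (F : A ⟶ B) : unit A ⋙ (freeMap F).obj ≅ F.toFunctor ⋙ unit B :=
  (restrictUnit A (freeCFS B)).objObjPreimageIso (F.toFunctor ⋙ unit B)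

/-- The components of `freeMapIso`. -/
def freeMapHom (F : A ⟶ B) (c : A) :
    (freeMap.{v, u} F).obj.obj ((unit A).obj c) ⟶ (unit B).obj (F.toFunctor.obj c) :=
  (freeMapIso F).hom.app c

/-- The components of the inverse of `freeMapIso`. -/
def freeMapInv (F : A ⟶ B) (c : A) :
    (unit B).obj (F.toFunctor.obj c) ⟶ (freeMap.{v, u} F).obj.obj ((unit A).obj c) :=
  (freeMapIso F).inv.app c

@[simp]
theorem freeMapHom_inv (F : A ⟶ B) (c : A) :
    freeMapHom.{v, u} F c ≫ freeMapInv F c = 𝟙 _ :=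
  (freeMapIso F).hom_inv_id_app c

@[simp]
theorem freeMapInv_hom (F : A ⟶ B) (c : A) :
    freeMapInv.{v, u} F c ≫ freeMapHom F c = 𝟙 _ :=
  (freeMapIso F).inv_hom_id_app c

@[simp]
theorem freeMapInv_hom_assoc (F : A ⟶ B) (c : A) {X : (freeCFS.{v, u} B).carrier}
    (f : (unit B).obj (F.toFunctor.obj c) ⟶ X) : freeMapInv F c ≫ freeMapHom F c ≫ f = f := by
  rw [← Category.assoc, freeMapInv_hom, Category.id_comp]

@[simp]
theorem map_freeMapInv_hom {E : Type*} [Category* E] (F : A ⟶ B) (c : A)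
    (S : (freeCFS.{v, u} B).carrier ⥤ E) :
    S.map (freeMapInv F c) ≫ S.map (freeMapHom F c) = 𝟙 _ := by
  rw [← S.map_comp, freeMapInv_hom, S.map_id]

@[simp]
theorem map_freeMapInv_hom_assoc {E : Type*} [Category* E] (F : A ⟶ B) (c : A)
    (S : (freeCFS.{v, u} B).carrier ⥤ E) {X : E}
    (f : S.obj ((unit B).obj (F.toFunctor.obj c)) ⟶ X) :
    S.map (freeMapInv F c) ≫ S.map (freeMapHom F c) ≫ f = f := by
  rw [← Category.assoc, ← S.map_comp, freeMapInv_hom, S.map_id, Category.id_comp]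

theorem freeMapInv_naturality_assoc (F : A ⟶ B) {c c' : A} (t : c ⟶ c')
    {X : (freeCFS.{v, u} B).carrier} (f : (freeMap F).obj.obj ((unit A).obj c') ⟶ X) :
    freeMapInv F c ≫ (freeMap F).obj.map ((unit A).map t) ≫ f =
      (unit B).map (F.toFunctor.map t) ≫ freeMapInv F c' ≫ f := by
  have h : freeMapInv F c ≫ (freeMap F).obj.map ((unit A).map t) =
      (unit B).map (F.toFunctor.map t) ≫ freeMapInv F c' :=
    ((freeMapIso F).inv.naturality t).symm
  rw [← Category.assoc, h, Category.assoc]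

/-- The action of `ℐ` on natural transformations. -/
def freeMap₂ {F G : A ⟶ B} (η : F ⟶ G) : freeMap.{v, u} F ⟶ freeMap G :=
  extendHom ((freeMapIso F).hom ≫ Functor.whiskerRight η.toNatTrans (unit B) ≫ (freeMapIso G).inv)

theorem freeMap₂_app {F G : A ⟶ B} (η : F ⟶ G) (c : A) :
    (freeMap₂.{v, u} η).hom.app ((unit A).obj c) =
      freeMapHom F c ≫ (unit B).map (η.toNatTrans.app c) ≫ freeMapInv G c :=
  extendHom_app _ c

/-- `ℐ` preserves identities. -/
def freeMapId (A : Cat.{v, max u (v + 1)}) : freeMap.{v, u} (𝟙 A) ≅ 𝟙 (freeCFS A) :=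
  extendIso (freeMapIso (𝟙 A))

theorem freeMapId_hom_app (A : Cat.{v, max u (v + 1)}) (c : A) :
    (freeMapId.{v, u} A).hom.hom.app ((unit A).obj c) = freeMapHom (𝟙 A) c :=
  extendIso_hom_app _ c

/-- `ℐ` preserves composition. -/
def freeMapComp {A₁ A₂ A₃ : Cat.{v, max u (v + 1)}} (F : A₁ ⟶ A₂) (G : A₂ ⟶ A₃) :
    freeMap.{v, u} (F ≫ G) ≅ freeMap F ≫ freeMap G :=
  extendIso (freeMapIso (F ≫ G) ≪≫
    (Functor.isoWhiskerLeft F.toFunctor (freeMapIso G)).symm ≪≫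
    Functor.isoWhiskerRight (freeMapIso F).symm (freeMap G).obj)

theorem freeMapComp_hom_app {A₁ A₂ A₃ : Cat.{v, max u (v + 1)}} (F : A₁ ⟶ A₂) (G : A₂ ⟶ A₃)
    (c : A₁) : (freeMapComp.{v, u} F G).hom.hom.app ((unit A₁).obj c) =
      freeMapHom (F ≫ G) c ≫ freeMapInv G (F.toFunctor.obj c) ≫
        (freeMap G).obj.map (freeMapInv F c) :=
  extendIso_hom_app _ c

theorem freeMapComp_inv_app {A₁ A₂ A₃ : Cat.{v, max u (v + 1)}} (F : A₁ ⟶ A₂) (G : A₂ ⟶ A₃)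
    (c : A₁) : (freeMapComp.{v, u} F G).inv.hom.app ((unit A₁).obj c) =
      (freeMap G).obj.map (freeMapHom F c) ≫
      freeMapHom G (F.toFunctor.obj c) ≫ freeMapInv (F ≫ G) c := by
  refine (extendIso_inv_app _ c).trans ?_
  exact Category.assoc _ _ _

/-- The pseudofunctor `ℐ`. -/
def free : Cat.{v, max u (v + 1)} ⥤ᵖ CFS.{v, max u (v + 1)} where
  obj := freeCFS.{v, u}
  map := freeMap
  map₂ := freeMap₂
  map₂_id F := hom₂_ext_unit fun c => by
    rw [freeMap₂_app]
    refine Eq.trans ?_ (freeMapHom_inv F c)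
    simp
  map₂_comp {_ _ F G H} η θ := hom₂_ext_unit fun c => by
    refine (freeMap₂_app _ c).trans ?_
    refine Eq.trans ?_ (congrArg₂ (· ≫ ·) (freeMap₂_app η c) (freeMap₂_app θ c)).symm
    simp
  mapId := freeMapId
  mapComp := freeMapComp
  map₂_whisker_left F G H η := hom₂_ext_unit fun c => by
    refine (freeMap₂_app _ c).trans ?_
    change _ = (freeMapComp F G).hom.hom.app _ ≫
      (freeMap₂ η).hom.app ((freeMap F).obj.obj ((unit _).obj c)) ≫
      (freeMapComp F H).inv.hom.app ((unit _).obj c)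
    -- The component sits at the image of `Y c` under `freeMap F`, which is only isomorphic to a
    -- representable. Naturality moves it to `Y (F c)`, where its value is known.
    have h := (freeMap₂ η).hom.naturality (freeMapInv F c)
    rw [freeMapComp_hom_app, freeMapComp_inv_app, Category.assoc, Category.assoc, reassoc_of% h,
      map_freeMapInv_hom_assoc, freeMap₂_app]
    simp
  map₂_whisker_right {_ _ _ F G} η H := hom₂_ext_unit fun c => by
    refine (freeMap₂_app _ c).trans ?_
    change _ = (freeMapComp F H).hom.hom.app _ ≫
      (freeMap H).obj.map ((freeMap₂ η).hom.app ((unit _).obj c)) ≫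
      (freeMapComp G H).inv.hom.app ((unit _).obj c)
    rw [freeMapComp_hom_app, freeMapComp_inv_app, freeMap₂_app]
    simp [freeMapInv_naturality_assoc]
  map₂_associator F G H := hom₂_ext_unit fun c => by
    refine (freeMap₂_app _ c).trans ?_
    change _ = (freeMapComp (F ≫ G) H).hom.hom.app _ ≫
      (freeMap H).obj.map ((freeMapComp F G).hom.hom.app ((unit _).obj c)) ≫ 𝟙 _ ≫
      (freeMapComp G H).inv.hom.app ((freeMap F).obj.obj ((unit _).obj c)) ≫
      (freeMapComp F (G ≫ H)).inv.hom.app ((unit _).obj c)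
    -- The same transport to an actual representable, now for the composition constraint.
    have h := (freeMapComp G H).inv.hom.naturality (freeMapInv F c)
    change (freeMap H).obj.map ((freeMap G).obj.map (freeMapInv F c)) ≫ _ =
      _ ≫ (freeMap (G ≫ H)).obj.map (freeMapInv F c) at h
    simp [freeMapComp_hom_app, freeMapComp_inv_app, reassoc_of% h]
  map₂_left_unitor F := hom₂_ext_unit fun c => by
    refine (freeMap₂_app _ c).trans ?_
    change _ = (freeMapComp (𝟙 _) F).hom.hom.app _ ≫
      (freeMap F).obj.map ((freeMapId _).hom.hom.app ((unit _).obj c)) ≫ 𝟙 _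
    simp [freeMapComp_hom_app, freeMapId_hom_app]
  map₂_right_unitor F := hom₂_ext_unit fun c => by
    refine (freeMap₂_app _ c).trans ?_
    change _ = (freeMapComp F (𝟙 _)).hom.hom.app _ ≫
      (freeMapId _).hom.hom.app ((freeMap F).obj.obj ((unit _).obj c)) ≫ 𝟙 _
    simp [freeMapComp_hom_app, freeMapId_hom_app]

/-- The Yoneda embeddings form a pseudonatural transformation. -/
def freeUnit : Pseudofunctor.StrongTrans (Pseudofunctor.id Cat.{v, max u (v + 1)})
    (free.{v, u}.comp forget.{v, max u (v + 1)}) where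
  app A := Cat.Hom.ofFunctor (unit A)
  naturality F := Cat.Hom.isoMk (freeMapIso F).symm
  naturality_naturality {A B F G} η := by
    refine Cat.Hom₂.ext (NatTrans.ext (funext fun (c : A) => ?_))
    change (unit _).map (η.toNatTrans.app c) ≫ freeMapInv G c =
      freeMapInv F c ≫ (freeMap₂ η).hom.app ((unit _).obj c)
    rw [freeMap₂_app, freeMapInv_hom_assoc]
  naturality_id A := by
    refine Cat.Hom₂.ext (NatTrans.ext (funext fun (c : A) => ?_))
    change freeMapInv (𝟙 A) c ≫ (freeMapId A).hom.hom.app ((unit _).obj c) ≫ 𝟙 _ =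
      (unit A).map (𝟙 c) ≫ 𝟙 _ ≫ 𝟙 _
    rw [freeMapId_hom_app]
    simp
  naturality_comp {A₁ A₂ A₃} F G := by
    refine Cat.Hom₂.ext (NatTrans.ext (funext fun (c : A₁) => ?_))
    change freeMapInv (F ≫ G) c ≫ (freeMapComp F G).hom.hom.app ((unit _).obj c) ≫ 𝟙 _ =
      (unit _).map (𝟙 _) ≫ 𝟙 _ ≫ freeMapInv G (F.toFunctor.obj c) ≫ 𝟙 _ ≫
        (freeMap G).obj.map (freeMapInv F c) ≫ 𝟙 _
    rw [freeMapComp_hom_app]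
    simp

/-- Up to the packaging of functors as 1-cells of `Cat`, this functor is `restrictUnit`. -/
theorem isBiuniversal_unit (A : Cat.{v, max u (v + 1)}) :
    IsBiuniversal forget.{v, max u (v + 1)} (x := freeCFS.{v, u} A)
      (Cat.Hom.ofFunctor (unit A)) := by
  intro X
  exact
    { faithful := ⟨fun {S T} α β h => hom₂_ext_unit fun c => by
        exact NatTrans.congr_app (congrArg Cat.Hom₂.toNatTrans h) c⟩
      full := ⟨fun {S T} α => ⟨extendHom α.toNatTrans, by
        ext c
        exact extendHom_app _ c⟩⟩
      essSurj := ⟨fun G => ⟨(restrictUnit A X).objPreimage G.toFunctor,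
        ⟨Cat.Hom.isoMk ((restrictUnit A X).objObjPreimageIso G.toFunctor)⟩⟩⟩ }

end Envelope

end IsbellMonad

end

/-! ### The theorem -/

open IsbellMonad in
theorem theorem3p3 :
    (∀ (C : Type u) [Category.{v} C],
      (Envelope.classes C).IsFactorizationSystem ∧
      ∀ (D : Type w) [Category.{v} D] (T : CylinderClasses D), T.IsFactorizationSystem →
        (Envelope.restrict C T).IsEquivalence) ∧
    ∃ h : ∀ C : Cat.{v, max u (v + 1)}, (Envelope.classes C).IsFactorizationSystem,
      ∃ B : LeftBiadjoint forget.{v, max u (v + 1)},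
        ∀ C : Cat.{v, max u (v + 1)},
          (⟨B.L.obj C, B.unit.app C⟩ : Σ X : CFS.{v, max u (v + 1)}, C ⟶ forget.obj X) =
            ⟨Envelope.toCFS C (h C), Cat.Hom.ofFunctor (Envelope.Y C)⟩ :=
  ⟨fun C _ => ⟨Envelope.isFactorizationSystem_classes C,
      fun _ _ _ hT => Envelope.isEquivalence_restrict hT⟩,
    fun C => Envelope.isFactorizationSystem_classes C,
    -- The value and the unit agree definitionally: only the action on 1-cells and 2-cells involved
    -- choices.
    ⟨Envelope.free, Envelope.freeUnit, Envelope.isBiuniversal_unit⟩, fun _ => rfl⟩
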